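/- Let $\Lambda\subset\mathbb{R}^d$ be bounded and closed with $0\in\Lambda$, and suppose that $\Lambda\cap B(0,r)$ has positive Lebesgue measure for every $r>0$. Let $C$ be a complex function such that $(x,y)\mapsto C(x-y)$ is continuous on $\Lambda\times\Lambda$, with $C(0)\neq 0$. Let $\varphi$ be a homogeneous zero-mean complex Gaussian scalar field on $\Lambda$ with covariance $C(x-y)$, that is, a random element of $L^2(\Lambda;\mathbb{C})$ on a probability space $(\Omega,\mathbb{P})$ such that for all $f,g\in L^2(\Lambda;\mathbb{C})$ the variable $\langle f,\varphi\rangle$ is a centred circular complex Gaussian (i.e. Gaussian with $\mathbb{E}\langle f,\varphi\rangle=\mathbb{E}\langle f,\varphi\rangle^2=0$) and $\mathbb{E}\big[\langle f,\varphi\rangle\langle \varphi,g\rangle\big]=\int_\Lambda\int_\Lambda \overline{f(x)}\,C(x-y)\,g(y)\,dy\,dx$. Then: 1. The value $\varphi(0)$, and hence $\mathcal{Q}=|\varphi(0)|^2$, exists almost surely. Precisely, there is a complex random variable $\varphi(0)$ such that: $\varphi$ has a Karhunen--Loève expansion $\varphi=\sum_n\xi_n\psi_n$ (converging in mean square in $L^2(\Lambda;\mathbb{C})$,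 with $\psi_n$ continuous on $\Lambda$ and $\xi_n$ independent centred circular complex Gaussian variables), and for every such expansion $\sum_n\xi_n\psi_n(0)$ converges almost surely to $\varphi(0)$; moreover, almost surely, if the realization of $\varphi$ has a representative which is continuous at $0$ relative to $\Lambda$, then $\varphi(0)$ is the value at $0$ of that representative. 2. For $u>0$ let $\mathbb{P}_u$ be the conditional probability given $\mathcal{Q}>u$, and $\mathbb{E}_u$ its expectation. There is a random phase $\theta\in[0,2\pi)$ with $\varphi(0)=|\varphi(0)|e^{i\theta}$, uniformly distributed over $[0,2\pi)$ under $\mathbb{P}$ and under every $\mathbb{P}_u$, such that $\varphi/\|\varphi\|_2\to e^{i\theta}\,C/\|C\|_2$ as $\mathcal{Q}\to+\infty$ in $L^2$ and in probability: for every $\varepsilon>0$, $$\lim_{u\to+\infty}\mathbb{P}_u\left(\left\|\frac{\varphi}{\|\varphi\|_2}-e^{i\theta}\frac{C}{\|C\|_2}\right\|_2>\varepsilon\right)=0,\qquad\text{and also}\qquad \lim_{u\to+\infty}\mathbb{E}_u\left\|\frac{\varphi}{\|\varphi\|_2}-e^{i\theta}\frac{C}{\|C\|_2}\right\|_2^2=0,$$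 where $\|\cdot\|_2$ is the norm of $L^2(\Lambda;\mathbb{C})$. -/

import Mathlib

open MeasureTheory ProbabilityTheory Filter Topology
open scoped ENNReal ComplexConjugate

/-- A centred circular complex Gaussian random variable: its law on `ℂ ≅ ℝ²` is Gaussian (possibly
degenerate), with `𝔼 X = 0` and `𝔼 X² = 0`. -/
structure IsCircularGaussian {Ω : Type*} [MeasurableSpace Ω] (X : Ω → ℂ) (P : Measure Ω) :
    Prop where
  hasGaussianLaw : HasGaussianLaw X P
  mean_zero : ∫ ω, X ω ∂P = 0
  pseudo_variance_zero : ∫ ω, X ω ^ 2 ∂P = 0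

/-- The Hilbert space `L²(Λ; ℂ)` for Lebesgue measure on `Λ ⊆ ℝᵈ`. -/
abbrev FieldSpace {d : ℕ} (Λ : Set (EuclideanSpace ℝ (Fin d))) : Type :=
  Lp ℂ 2 ((volume : Measure (EuclideanSpace ℝ (Fin d))).restrict Λ)

/-- `φ` is a random element of `L²(Λ; ℂ)` whose law is the centred (circular) complex Gaussian
measure with covariance operator the integral operator of kernel `C (x - y)`: every `⟨f, φ⟩` is a
centred circular complex Gaussian variable, and `𝔼[⟨f, φ⟩ ⟨φ, g⟩] = ⟨f, Ĉ g⟩` where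
`(Ĉ g)(x) = ∫_Λ C (x - y) g(y) dy`. -/
structure IsHomogeneousGaussianField {d : ℕ} (Λ : Set (EuclideanSpace ℝ (Fin d)))
    (C : EuclideanSpace ℝ (Fin d) → ℂ) {Ω : Type*} [MeasurableSpace Ω]
    (φ : Ω → FieldSpace Λ) (P : Measure Ω) : Prop where
  gaussian : ∀ f : FieldSpace Λ, IsCircularGaussian (fun ω => inner ℂ f (φ ω)) P
  covariance : ∀ f g : FieldSpace Λ,
    ∫ ω, inner ℂ f (φ ω) * inner ℂ (φ ω) g ∂P
      = ∫ x in Λ, conj (f x) * ∫ y in Λ, C (x - y) * g y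

/-- A (generalized) Karhunen-Loeve expansion `φ = ∑ₙ ξₙ ψₙ`: the profiles `ψₙ` are continuous on
`Λ`, the coefficients `ξₙ` are independent centred circular complex Gaussian variables, and the
series converges to `φ` in mean square in `L²(Λ; ℂ)`. -/
structure IsKarhunenLoeve {d : ℕ} (Λ : Set (EuclideanSpace ℝ (Fin d)))
    {Ω : Type*} [MeasurableSpace Ω] (φ : Ω → FieldSpace Λ) (P : Measure Ω)
    (ψ : ℕ → EuclideanSpace ℝ (Fin d) → ℂ) (ξ : ℕ → Ω → ℂ) : Prop where
  continuousOn : ∀ n, ContinuousOn (ψ n) Λ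
  gaussian : ∀ n, IsCircularGaussian (ξ n) P
  indep : iIndepFun ξ P
  expansion : Tendsto (fun N : ℕ => ∫⁻ ω,
      eLpNorm (fun x => φ ω x - ∑ n ∈ Finset.range N, ξ n ω * ψ n x) 2 (volume.restrict Λ) ^ 2 ∂P)
    atTop (𝓝 0)

/-- `φ₀` is the value at the point `0` of the random element `φ` of `L²(Λ; ℂ)`:
* `φ` has a Karhunen-Loeve expansion with continuous profiles, and for every such expansion the
  series evaluated at `0` converges almost surely, to `φ₀`;
* almost surely, whenever the realization `φ ω` has a representative which is continuous at `0`
  (relative to `Λ`), `φ₀ ω` is the value at `0` of that representative. -/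
structure IsValueAtZero {d : ℕ} (Λ : Set (EuclideanSpace ℝ (Fin d)))
    {Ω : Type*} [MeasurableSpace Ω] (φ : Ω → FieldSpace Λ) (P : Measure Ω) (φ₀ : Ω → ℂ) :
    Prop where
  measurable : Measurable φ₀
  exists_expansion : ∃ ψ ξ, IsKarhunenLoeve Λ φ P ψ ξ
  series_tendsto : ∀ ψ ξ, IsKarhunenLoeve Λ φ P ψ ξ →
    ∀ᵐ ω ∂P, Tendsto (fun N : ℕ => ∑ n ∈ Finset.range N, ξ n ω * ψ n 0) atTop (𝓝 (φ₀ ω))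
  eq_of_continuous : ∀ᵐ ω ∂P, ∀ f : EuclideanSpace ℝ (Fin d) → ℂ,
    f =ᵐ[volume.restrict Λ] φ ω → ContinuousWithinAt f Λ 0 → φ₀ ω = f 0

/-- `f / ‖f‖₂`, with the norm of `L²(Λ; ℂ)`. -/
noncomputable def l2Normalize {d : ℕ} (Λ : Set (EuclideanSpace ℝ (Fin d)))
    (f : EuclideanSpace ℝ (Fin d) → ℂ) : EuclideanSpace ℝ (Fin d) → ℂ :=
  fun x => f x / ((eLpNorm f 2 (volume.restrict Λ)).toReal : ℂ)

/-- The distance `‖ f/‖f‖₂ - e^{iθ} g/‖g‖₂ ‖₂` in `L²(Λ; ℂ)`. -/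
noncomputable def profileDist {d : ℕ} (Λ : Set (EuclideanSpace ℝ (Fin d)))
    (f g : EuclideanSpace ℝ (Fin d) → ℂ) (θ : ℝ) : ℝ≥0∞ :=
  eLpNorm (fun x => l2Normalize Λ f x - Complex.exp (θ * Complex.I) * l2Normalize Λ g x) 2
    (volume.restrict Λ)

/-! The argument takes place in two Hilbert spaces, `L²(Λ; ℂ)` and `L²(Ω; ℂ)`, linked by the
conjugate-linear map `T f = ⟨f, φ⟩` (`coefficientMap`). It is bounded because `φ` is a Gaussian
element of a separable Hilbert space, hence square integrable by Fernique's theorem, and the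
covariance condition reads `⟨T f, T g⟩ = ⟨g, Ĉ f⟩` with `Ĉ f` continuous on `Λ`.

*The value at `0`.* Let `hₖ` be the normalised indicator of the ball of radius `1 / (k + 1)`. Since
`⟨T hₖ, T hₗ⟩` is a double average of `C (x - y)` near the origin, it tends to `C 0`, so `T hₖ`
converges in mean square to some `Y` with `‖Y‖² = C 0` (`exists_tendsto_ballAverage`); `Y` is the
value `φ(0)`. A realization continuous at `0` has convergent averages, which identifies its value
there with `Y` along an almost surely convergent subsequence. Gram-Schmidt in the range of `T`
yields an orthogonal family `T fₙ`, and `φ = ∑ₙ ⟨fₙ, φ⟩ Ĉ fₙ` is an expansion with continuous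
profiles; no spectral theorem is needed (`exists_isKarhunenLoeve`). For an arbitrary expansion,
the independent `ξₙ` form an orthogonal family along which `Y` has Fourier coefficients `ψₙ(0)`
and whose closed span contains `Y`; hence `∑ₙ ξₙ ψₙ(0)` converges to `Y` in mean square, and almost
surely by martingale convergence (`ae_tendsto_series`).

*Gaussianity.* Joint circular Gaussianity of a subspace of `L²(Ω; ℂ)` is encoded by the single
identity `𝔼 exp(i Re X) = exp(-‖X‖² / 4)` (`HasCircularLaw`). It survives `L²` limits, so that it
holds on the closure of the range of `T`, in particular for `Y`. By Pythagoras' theorem it turns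
orthogonality into factorisation of characteristic functionals, that is, into independence
(`iIndepFun_of_orthogonal`, `indepFun_of_orthogonal`), and it makes the law of `Y` rotation
invariant, whence the uniform phase, by uniqueness of the Haar measure of the circle
(`map_phase_eq_uniform`).

*The limit.* As `⟨Y, T f⟩ = ⟨f, C⟩`, the remainder `χ = φ - (Y / C 0) C` is orthogonal to `Y`, thus
independent of it (`indepFun_remainder`). Normalisation gives
`‖φ/‖φ‖ - e^{iθ} C/‖C‖‖ ≤ 2 C(0) ‖χ‖ / (|Y| ‖C‖)` (`profileDist_le`), so that the conditional second
moment given `|Y|² > u` is at most a constant times `𝔼‖χ‖² / u`. Convergence in probability follows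
from Markov's inequality. -/

/-! ### Orthogonal families in Hilbert spaces -/

section Hilbert

variable {E F : Type*} [NormedAddCommGroup E] [InnerProductSpace ℂ E]
  [NormedAddCommGroup F] [InnerProductSpace ℂ F]

/-- Partial expansions along an orthogonal family are best approximations. -/
theorem norm_sub_orthogonal_expansion_le {v : ℕ → E}
    (hv : Pairwise fun i j => inner ℂ (v i) (v j) = 0) {x : E} {a : ℕ → ℂ}
    (ha : ∀ n, inner ℂ (v n) x = a n * (‖v n‖ : ℂ) ^ 2) (N : ℕ) {y : E}
    (hy : y ∈ Submodule.span ℂ (v '' Set.Iio N)) :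
    ‖x - ∑ n ∈ Finset.range N, a n • v n‖ ≤ ‖x - y‖ := by
  set S := ∑ n ∈ Finset.range N, a n • v n with hS
  have h1 : ∀ m < N, inner ℂ (v m) (x - S) = 0 := by
    intro m hm
    rw [inner_sub_right, ha, hS, inner_sum, Finset.sum_eq_single m]
    · rw [inner_smul_right, inner_self_eq_norm_sq_to_K]; simp
    · intro n _ hn
      rw [inner_smul_right, hv hn.symm, mul_zero]
    · intro h; simp at h; omega
  have h2 : ∀ z ∈ Submodule.span ℂ (v '' Set.Iio N), inner ℂ z (x - S) = 0 := by
    intro z hz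
    induction hz using Submodule.span_induction with
    | mem z hz => obtain ⟨m, hm, rfl⟩ := hz; exact h1 m hm
    | zero => simp
    | add z w _ _ hz hw => rw [inner_add_left, hz, hw, add_zero]
    | smul c z _ hz => rw [inner_smul_left, hz, mul_zero]
  have h3 : S ∈ Submodule.span ℂ (v '' Set.Iio N) :=
    Submodule.sum_mem _ fun n hn => Submodule.smul_mem _ _
      (Submodule.subset_span ⟨n, by simpa using hn, rfl⟩)
  have h4 := h2 _ (Submodule.sub_mem _ h3 hy)
  have h5 : ‖(x - S) + (S - y)‖ * ‖(x - S) + (S - y)‖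
      = ‖x - S‖ * ‖x - S‖ + ‖S - y‖ * ‖S - y‖ :=
    norm_add_sq_eq_norm_sq_add_norm_sq_of_inner_eq_zero (𝕜 := ℂ) _ _
      (by rw [← inner_conj_symm, h4, map_zero])
  rw [sub_add_sub_cancel] at h5
  nlinarith [norm_nonneg (x - S), norm_nonneg (x - y), norm_nonneg (S - y),
    mul_self_nonneg ‖S - y‖]

/-- Fourier expansion along an orthogonal family, some members of which may vanish. -/
theorem tendsto_orthogonal_expansion {v : ℕ → E}
    (hv : Pairwise fun i j => inner ℂ (v i) (v j) = 0) {x : E}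
    (hx : x ∈ closure (Submodule.span ℂ (Set.range v) : Set E)) {a : ℕ → ℂ}
    (ha : ∀ n, inner ℂ (v n) x = a n * (‖v n‖ : ℂ) ^ 2) :
    Tendsto (fun N => ∑ n ∈ Finset.range N, a n • v n) atTop (𝓝 x) := by
  have key : ∀ y ∈ Submodule.span ℂ (Set.range v),
      ∃ N₀, ∀ N ≥ N₀, y ∈ Submodule.span ℂ (v '' Set.Iio N) := by
    intro y hy
    induction hy using Submodule.span_induction with
    | mem y hy =>
      obtain ⟨m, rfl⟩ := hy
      exact ⟨m + 1, fun N hN => Submodule.subset_span ⟨m, by simp; omega, rfl⟩⟩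
    | zero => exact ⟨0, fun N _ => Submodule.zero_mem _⟩
    | add y z _ _ hy hz =>
      obtain ⟨N, hN⟩ := hy
      obtain ⟨M, hM⟩ := hz
      exact ⟨max N M, fun K hK => Submodule.add_mem _ (hN K (le_of_max_le_left hK))
        (hM K (le_of_max_le_right hK))⟩
    | smul c y _ hy =>
      obtain ⟨N, hN⟩ := hy
      exact ⟨N, fun K hK => Submodule.smul_mem _ _ (hN K hK)⟩
  rw [Metric.tendsto_atTop]
  intro ε hε
  obtain ⟨y, hy, hxy⟩ := Metric.mem_closure_iff.1 hx ε hε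
  obtain ⟨N₀, hN₀⟩ := key y hy
  refine ⟨N₀, fun N hN => ?_⟩
  rw [dist_comm, dist_eq_norm]
  rw [dist_eq_norm] at hxy
  exact (norm_sub_orthogonal_expansion_le hv ha N (hN₀ N hN)).trans_lt hxy

/-- Gram-Schmidt in the range of a conjugate-linear map. Members of the resulting family may
vanish: linear independence is not available. -/
theorem exists_orthonormal_or_zero_range [TopologicalSpace.SeparableSpace E] (T : E →L⋆[ℂ] F) :
    ∃ f : ℕ → E, (Pairwise fun i j => inner ℂ (T (f i)) (T (f j)) = 0) ∧
      (∀ n, T (f n) = 0 ∨ ‖T (f n)‖ = 1) ∧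
      ∀ g, T g ∈ closure (Submodule.span ℂ (Set.range fun n => T (f n)) : Set F) := by
  set g := TopologicalSpace.denseSeq E
  set v : ℕ → F := fun n => T (g n)
  set w := InnerProductSpace.gramSchmidtNormed ℂ v
  have hspan : Submodule.span ℂ (Set.range w) = Submodule.span ℂ (Set.range v) :=
    (InnerProductSpace.span_gramSchmidtNormed_range v).trans
      (InnerProductSpace.span_gramSchmidt ℂ v)
  have hw : ∀ n, ∃ f, T f = w n := by
    intro n
    have h1 : w n ∈ Submodule.span ℂ (Set.range v) :=
      hspan ▸ Submodule.subset_span ⟨n, rfl⟩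
    have h2 : Submodule.span ℂ (Set.range v) ≤ LinearMap.range T.toLinearMap := by
      rw [Submodule.span_le]
      rintro _ ⟨m, rfl⟩
      exact ⟨g m, rfl⟩
    exact h2 h1
  choose f hf using hw
  have hrange : (fun n => T (f n)) = w := funext hf
  refine ⟨f, ?_, ?_, ?_⟩
  · intro i j hij
    rw [hf, hf]
    simp only [w, InnerProductSpace.gramSchmidtNormed, inner_smul_left, inner_smul_right,
      InnerProductSpace.gramSchmidt_orthogonal ℂ v hij, mul_zero]
  · intro n
    rw [hf]
    by_cases h : w n = 0
    · exact Or.inl h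
    · exact Or.inr (InnerProductSpace.gramSchmidtNormed_unit_length' h)
  · intro x
    rw [hrange, hspan]
    have h1 : x ∈ closure (Set.range g) := TopologicalSpace.denseRange_denseSeq E x
    refine closure_mono ?_ (image_closure_subset_closure_image T.continuous ⟨x, h1, rfl⟩)
    rintro _ ⟨_, ⟨n, rfl⟩, rfl⟩
    exact Submodule.subset_span ⟨n, rfl⟩

/-- A separable Hilbert space has a countable Hilbert basis. -/
theorem exists_countable_hilbertBasis (E : Type*) [NormedAddCommGroup E] [InnerProductSpace ℂ E]
    [CompleteSpace E] [TopologicalSpace.SeparableSpace E] :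
    ∃ (w : Set E) (_ : HilbertBasis w ℂ E), w.Countable := by
  obtain ⟨w, b, hb⟩ := exists_hilbertBasis ℂ E
  refine ⟨w, b, ?_⟩
  refine Set.PairwiseDisjoint.countable_of_isOpen (s := fun x : E => Metric.ball x (1 / 2))
    ?_ (fun _ _ => Metric.isOpen_ball) (fun x _ => ⟨x, by simp⟩)
  intro x hx y hy hxy
  apply Metric.ball_disjoint_ball
  have ho := b.orthonormal
  rw [hb] at ho
  have hne : (⟨x, hx⟩ : w) ≠ ⟨y, hy⟩ := fun h => hxy (congrArg Subtype.val h)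
  have h0 : inner ℂ x y = 0 := ho.2 hne
  have h1 : ‖x‖ = 1 := ho.1 ⟨x, hx⟩
  have h2 : ‖y‖ = 1 := ho.1 ⟨y, hy⟩
  have h3 : ‖x - y‖ * ‖x - y‖ = 2 := by
    rw [sub_eq_add_neg, norm_add_sq_eq_norm_sq_add_norm_sq_of_inner_eq_zero (𝕜 := ℂ) x (-y)
      (by rw [inner_neg_right, h0, neg_zero]), norm_neg, h1, h2]; norm_num
  rw [dist_eq_norm]
  nlinarith [norm_nonneg (x - y)]

end Hilbert

/-- Stability of normalisation; the bound also holds for `a = 0`, which is normalised to `0`. -/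
theorem norm_normalize_sub_le {E : Type*} [NormedAddCommGroup E] [NormedSpace ℂ E] (a : E) {b : E}
    (hb : b ≠ 0) :
    ‖((‖a‖ : ℂ)⁻¹) • a - ((‖b‖ : ℂ)⁻¹) • b‖ ≤ 2 * ‖a - b‖ / ‖b‖ := by
  have hb' : 0 < ‖b‖ := norm_pos_iff.2 hb
  have e : ((‖a‖ : ℂ)⁻¹) • a - ((‖b‖ : ℂ)⁻¹) • b
      = ((‖b‖ : ℂ)⁻¹) • (a - b) + (((‖a‖ : ℂ)⁻¹) - (‖b‖ : ℂ)⁻¹) • a := by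
    rw [smul_sub, sub_smul]; abel
  have h1 : ‖(((‖a‖ : ℂ)⁻¹) - (‖b‖ : ℂ)⁻¹) • a‖ ≤ ‖a - b‖ / ‖b‖ := by
    by_cases ha : a = 0
    · subst ha; simp; positivity
    have ha' : 0 < ‖a‖ := norm_pos_iff.2 ha
    have : ((‖a‖ : ℂ)⁻¹) - (‖b‖ : ℂ)⁻¹ = (((‖b‖ - ‖a‖) / (‖a‖ * ‖b‖) : ℝ) : ℂ) := by
      push_cast
      have : (‖a‖ : ℂ) ≠ 0 := by exact_mod_cast ha'.ne'
      have : (‖b‖ : ℂ) ≠ 0 := by exact_mod_cast hb'.ne'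
      field_simp
    rw [this, norm_smul, Complex.norm_real, norm_div, norm_mul, norm_norm, norm_norm]
    rw [div_mul_eq_mul_div, mul_comm ‖a‖ ‖b‖, mul_div_mul_right _ _ ha'.ne']
    gcongr
    rw [Real.norm_eq_abs, abs_sub_comm]
    exact abs_norm_sub_norm_le a b
  calc _ ≤ ‖((‖b‖ : ℂ)⁻¹) • (a - b)‖ + ‖(((‖a‖ : ℂ)⁻¹) - (‖b‖ : ℂ)⁻¹) • a‖ := by
        rw [e]; exact norm_add_le _ _
    _ ≤ ‖a - b‖ / ‖b‖ + ‖a - b‖ / ‖b‖ := by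
        gcongr
        rw [norm_smul, norm_inv, Complex.norm_real, norm_norm, inv_mul_eq_div]
    _ = _ := by ring

/-! ### Circular Gaussian subspaces of `L²` -/

section CircularLaw

variable {Ω : Type*} [MeasurableSpace Ω] {P : Measure Ω}

/-- The characteristic function of a centred circular complex Gaussian variable of variance
`‖X‖²`, tested at the point `1`. For all members of a complex subspace of `L²(Ω; ℂ)` this
amounts to saying that the subspace consists of jointly circular Gaussian variables, and the
condition is visibly closed in `L²`. -/
def HasCircularLaw (X : Lp ℂ 2 P) : Prop :=
  ∫ ω, Complex.exp ((X ω).re * Complex.I) ∂P = Complex.exp (-‖X‖ ^ 2 / 4)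

theorem norm_exp_mul_I_sub_le (a b : ℝ) :
    ‖Complex.exp (a * Complex.I) - Complex.exp (b * Complex.I)‖ ≤ |a - b| := by
  have : Complex.exp (a * Complex.I) - Complex.exp (b * Complex.I)
      = Complex.exp (b * Complex.I) * (Complex.exp (Complex.I * ((a - b : ℝ) : ℂ)) - 1) := by
    rw [mul_sub, ← Complex.exp_add, mul_one]
    congr 2
    push_cast; ring
  rw [this, norm_mul, Complex.norm_exp_ofReal_mul_I, one_mul]
  exact Real.norm_exp_I_mul_ofReal_sub_one_le

theorem integrable_exp_re_mul_I [IsFiniteMeasure P] {X : Ω → ℂ}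
    (hX : AEStronglyMeasurable X P) :
    Integrable (fun ω => Complex.exp ((X ω).re * Complex.I)) P := by
  refine Integrable.of_bound (C := 1) ?_ (ae_of_all _ fun ω => ?_)
  · have : Continuous fun z : ℂ => Complex.exp (z.re * Complex.I) := by fun_prop
    exact this.comp_aestronglyMeasurable hX
  · rw [Complex.norm_exp_ofReal_mul_I]

theorem isClosed_hasCircularLaw [IsProbabilityMeasure P] :
    IsClosed {X : Lp ℂ 2 P | HasCircularLaw X} := by
  refine isClosed_eq ?_ (by fun_prop)
  refine LipschitzWith.continuous (K := 1) (LipschitzWith.of_dist_le_mul fun X Z => ?_)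
  rw [NNReal.coe_one, one_mul, dist_eq_norm, dist_eq_norm,
    ← integral_sub (integrable_exp_re_mul_I (Lp.aestronglyMeasurable X))
      (integrable_exp_re_mul_I (Lp.aestronglyMeasurable Z))]
  have h1 : Integrable (X - Z : Lp ℂ 2 P) P := (Lp.memLp (X - Z)).integrable (by norm_num)
  have h2 : ∫ ω, ‖(X - Z : Lp ℂ 2 P) ω‖ ∂P = (eLpNorm (X - Z : Lp ℂ 2 P) 1 P).toReal := by
    rw [eLpNorm_one_eq_lintegral_enorm, integral_norm_eq_lintegral_enorm h1.1]
  calc _ ≤ ∫ ω, ‖(X - Z : Lp ℂ 2 P) ω‖ ∂P := by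
        refine norm_integral_le_of_norm_le h1.norm ?_
        filter_upwards [Lp.coeFn_sub X Z] with ω hω
        rw [hω, Pi.sub_apply]
        refine (norm_exp_mul_I_sub_le _ _).trans ?_
        rw [← Complex.sub_re]
        exact Complex.abs_re_le_norm _
    _ ≤ ‖X - Z‖ := by
        rw [h2, Lp.norm_def]
        refine ENNReal.toReal_mono (Lp.eLpNorm_ne_top _) ?_
        exact eLpNorm_le_eLpNorm_of_exponent_le (by norm_num) h1.1

/-- A vanishing pseudo-variance splits the second moment evenly between real and imaginary part. -/
theorem integral_sq_re_of_pseudoVariance_zero {X : Ω → ℂ} (hX : MemLp X 2 P)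
    (h : ∫ ω, X ω ^ 2 ∂P = 0) :
    ∫ ω, (X ω).re ^ 2 ∂P = (∫ ω, ‖X ω‖ ^ 2 ∂P) / 2 := by
  have hre : Integrable (fun ω => (X ω).re ^ 2) P := hX.re.integrable_sq
  have him : Integrable (fun ω => (X ω).im ^ 2) P := hX.im.integrable_sq
  have hsq : Integrable (fun ω => X ω ^ 2) P := by
    simp only [pow_two]
    exact hX.integrable_mul hX
  have h1 : ∫ ω, ((X ω).re ^ 2 - (X ω).im ^ 2) ∂P = 0 := by
    have : ∫ ω, (X ω ^ 2).re ∂P = (∫ ω, X ω ^ 2 ∂P).re := integral_re hsq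
    rw [h, Complex.zero_re] at this
    rw [← this]
    refine integral_congr_ae (ae_of_all _ fun ω => ?_)
    simp [pow_two]
  have h2 : ∫ ω, ‖X ω‖ ^ 2 ∂P = ∫ ω, ((X ω).re ^ 2 + (X ω).im ^ 2) ∂P := by
    refine integral_congr_ae (ae_of_all _ fun ω => ?_)
    simp only [← Complex.normSq_eq_norm_sq, Complex.normSq_apply]; ring
  rw [integral_sub hre him] at h1
  rw [h2, integral_add hre him]
  linarith

theorem norm_sq_eq_integral (X : Lp ℂ 2 P) : ‖X‖ ^ 2 = ∫ ω, ‖X ω‖ ^ 2 ∂P := by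
  have h : ((‖X‖ ^ 2 : ℝ) : ℂ) = ((∫ ω, ‖X ω‖ ^ 2 ∂P : ℝ) : ℂ) := by
    rw [← integral_complex_ofReal]
    have := inner_self_eq_norm_sq_to_K (𝕜 := ℂ) X
    rw [L2.inner_def] at this
    push_cast
    rw [← Complex.coe_algebraMap, ← this]
    refine integral_congr_ae (ae_of_all _ fun ω => ?_)
    simp only [inner_self_eq_norm_sq_to_K]
  exact_mod_cast h

theorem IsCircularGaussian.hasCircularLaw {X : Ω → ℂ} (h : IsCircularGaussian X P) {Z : Lp ℂ 2 P}
    (hZ : Z =ᵐ[P] X) : HasCircularLaw Z := by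
  have := h.hasGaussianLaw.isProbabilityMeasure
  have hX : MemLp X 2 P := h.hasGaussianLaw.memLp_two
  have hre : HasGaussianLaw (fun ω => Complex.reCLM (X ω)) P := h.hasGaussianLaw.map_fun _
  have hint : Integrable X P := h.hasGaussianLaw.integrable
  have hm : ∫ ω, Complex.reCLM (X ω) ∂P = 0 := by
    rw [ContinuousLinearMap.integral_comp_comm _ hint, h.mean_zero, map_zero]
  have hc := hre.charFun_map_eq 1
  rw [charFun_apply, integral_map hre.aemeasurable (by fun_prop)] at hc
  unfold HasCircularLaw
  have e1 : ∫ ω, Complex.exp ((Z ω).re * Complex.I) ∂P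
      = ∫ ω, Complex.exp ((inner ℝ (Complex.reCLM (X ω)) 1 : ℝ) * Complex.I) ∂P := by
    refine integral_congr_ae ?_
    filter_upwards [hZ] with ω hω
    simp [hω]
  rw [e1, hc]
  have e2 : (fun ω => inner ℝ (1 : ℝ) (Complex.reCLM (X ω))) = fun ω => Complex.reCLM (X ω) := by
    ext ω; simp
  have hv : Var[fun ω => Complex.reCLM (X ω); P] = ‖Z‖ ^ 2 / 2 := by
    have e3 : ∫ ω, ‖Z ω‖ ^ 2 ∂P = ∫ ω, ‖X ω‖ ^ 2 ∂P :=
      integral_congr_ae (by filter_upwards [hZ] with ω h; rw [h])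
    rw [variance_of_integral_eq_zero hre.aemeasurable hm, norm_sq_eq_integral, e3]
    exact integral_sq_re_of_pseudoVariance_zero hX h.pseudo_variance_zero
  rw [e2, hm, hv]
  congr 1
  push_cast; ring

/-- Real functionals on a complex Hilbert space are real parts of complex inner products. -/
theorem exists_eq_re_inner {H : Type*} [NormedAddCommGroup H] [InnerProductSpace ℂ H]
    [CompleteSpace H] (L : StrongDual ℝ H) : ∃ f : H, ∀ x, L x = (inner ℂ f x).re := by
  refine ⟨(InnerProductSpace.toDual ℂ H).symm (StrongDual.extendRCLike (𝕜 := ℂ) L), fun x => ?_⟩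
  rw [InnerProductSpace.toDual_symm_apply]
  exact (StrongDual.re_extendRCLike_apply (𝕜 := ℂ) L x).symm

theorem norm_sum_sq_of_pairwise_orthogonal {E ι : Type*} [NormedAddCommGroup E]
    [InnerProductSpace ℂ E] {v : ι → E} (hv : Pairwise fun i j => inner ℂ (v i) (v j) = 0)
    (s : Finset ι) : ‖∑ i ∈ s, v i‖ ^ 2 = ∑ i ∈ s, ‖v i‖ ^ 2 := by
  classical
  induction s using Finset.induction_on with
  | empty => simp
  | insert i s hi ih =>
    have h0 : inner ℂ (v i) (∑ j ∈ s, v j) = 0 := by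
      rw [inner_sum]
      exact Finset.sum_eq_zero fun j hj => hv fun h => hi (h ▸ hj)
    rw [Finset.sum_insert hi, Finset.sum_insert hi, ← ih]
    have := norm_add_sq_eq_norm_sq_add_norm_sq_of_inner_eq_zero (𝕜 := ℂ) _ _ h0
    nlinarith

theorem charFunDual_map_of_hasCircularLaw {H : Type*} [NormedAddCommGroup H] [NormedSpace ℝ H]
    [MeasurableSpace H] [BorelSpace H] {χ : Ω → H} (hχ : AEMeasurable χ P) {L : StrongDual ℝ H}
    {X : Lp ℂ 2 P} (hX : HasCircularLaw X) (hLX : ∀ᵐ ω ∂P, L (χ ω) = (X ω).re) :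
    charFunDual (P.map χ) L = Complex.exp (-‖X‖ ^ 2 / 4) := by
  rw [charFunDual_apply, integral_map hχ (by fun_prop), ← hX]
  refine integral_congr_ae ?_
  filter_upwards [hLX] with ω h
  rw [h]

/-- Orthogonal members of a jointly circular Gaussian subspace are independent. -/
theorem iIndepFun_of_orthogonal [IsProbabilityMeasure P] {G : Submodule ℂ (Lp ℂ 2 P)}
    (hG : ∀ X ∈ G, HasCircularLaw X) {X : ℕ → Lp ℂ 2 P} (hX : ∀ n, X n ∈ G)
    (horth : Pairwise fun i j => inner ℂ (X i) (X j) = 0) {ξ : ℕ → Ω → ℂ}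
    (hξ : ∀ n, X n =ᵐ[P] ξ n) : iIndepFun ξ P := by
  classical
  have hmeas : ∀ n, AEMeasurable (ξ n) P := fun n =>
    ((Lp.aestronglyMeasurable (X n)).congr (hξ n)).aemeasurable
  rw [iIndepFun_iff_finset]
  intro s
  change iIndepFun (fun (i : s) => ξ i) P
  rw [iIndepFun_iff_charFunDual_pi (fun i : s => hmeas i)]
  intro L
  choose a ha using fun i : s =>
    exists_eq_re_inner (L ∘SL ContinuousLinearMap.single ℝ (fun _ : s => ℂ) i)
  have hL : ∀ x : s → ℂ, L x = ∑ i, (inner ℂ (a i) (x i)).re := by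
    intro x
    conv_lhs => rw [← Finset.univ_sum_single x]
    rw [map_sum]
    exact Finset.sum_congr rfl fun i _ => ha i (x i)
  have h1 : ∀ i : s, charFunDual (P.map (ξ i))
      (L ∘SL ContinuousLinearMap.single ℝ (fun _ : s => ℂ) i)
      = Complex.exp (-‖conj (a i) • X i‖ ^ 2 / 4) := by
    intro i
    refine charFunDual_map_of_hasCircularLaw (hmeas i) (hG _ (G.smul_mem _ (hX i))) ?_
    filter_upwards [hξ i, Lp.coeFn_smul (conj (a i)) (X i)] with ω h1 h2
    rw [ha i, h2, Pi.smul_apply, h1, smul_eq_mul, RCLike.inner_apply, mul_comm]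
  have h2 : charFunDual (P.map fun ω (i : s) => ξ i ω) L
      = Complex.exp (-‖∑ i : s, conj (a i) • X i‖ ^ 2 / 4) := by
    have hm : AEMeasurable (fun ω (i : s) => ξ i ω) P :=
      aemeasurable_pi_lambda _ fun i : s => hmeas i
    refine charFunDual_map_of_hasCircularLaw hm
      (hG _ (G.sum_mem fun i _ => G.smul_mem _ (hX i))) ?_
    have h3 : ∀ᵐ ω ∂P, ∀ i : s, (conj (a i) • X i : Lp ℂ 2 P) ω = conj (a i) * ξ i ω := by
      rw [ae_all_iff]
      intro i
      filter_upwards [hξ i, Lp.coeFn_smul (conj (a i)) (X i)] with ω h1 h2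
      rw [h2, Pi.smul_apply, h1, smul_eq_mul]
    filter_upwards [h3, Lp.coeFn_finsetSum Finset.univ fun i : s => conj (a i) • X i] with ω h4 h5
    rw [hL, h5, Finset.sum_apply, Complex.re_sum]
    refine Finset.sum_congr rfl fun i _ => ?_
    rw [h4, RCLike.inner_apply, mul_comm]
  have horth' : Pairwise fun i j : s => inner ℂ (conj (a i) • X i) (conj (a j) • X j) = 0 := by
    intro i j hij
    rw [inner_smul_left, inner_smul_right, horth fun h => hij (Subtype.ext h), mul_zero, mul_zero]
  change charFunDual (P.map fun ω (i : s) => ξ i ω) L = ∏ i : s, charFunDual (P.map (ξ i)) _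
  simp_rw [h1, h2]
  rw [← Complex.exp_sum]
  congr 1
  rw [← Finset.sum_div, Finset.sum_neg_distrib]
  congr 2
  exact_mod_cast norm_sum_sq_of_pairwise_orthogonal horth' Finset.univ

/-- A field and a variable which are jointly circular Gaussian and orthogonal are independent. -/
theorem indepFun_of_orthogonal [IsProbabilityMeasure P] {H : Type*} [NormedAddCommGroup H]
    [InnerProductSpace ℂ H] [CompleteSpace H] [SecondCountableTopology H] [MeasurableSpace H]
    [BorelSpace H] {G : Submodule ℂ (Lp ℂ 2 P)} (hG : ∀ X ∈ G, HasCircularLaw X)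
    {χ : Ω → H} (hχ : AEMeasurable χ P) {y : Ω → ℂ} {Y : Lp ℂ 2 P} (hYG : Y ∈ G)
    (hY : Y =ᵐ[P] y) {Z : H → Lp ℂ 2 P} (hZG : ∀ f, Z f ∈ G)
    (hZ : ∀ f, Z f =ᵐ[P] fun ω => inner ℂ f (χ ω)) (horth : ∀ f, inner ℂ Y (Z f) = 0) :
    IndepFun χ y P := by
  have hy : AEMeasurable y P := ((Lp.aestronglyMeasurable Y).congr hY).aemeasurable
  rw [indepFun_iff_charFunDual_prod hχ hy]
  intro L
  obtain ⟨f, hf⟩ := exists_eq_re_inner (L ∘SL ContinuousLinearMap.inl ℝ H ℂ)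
  obtain ⟨a, ha⟩ := exists_eq_re_inner (L ∘SL ContinuousLinearMap.inr ℝ H ℂ)
  have hL : ∀ x z, L (x, z) = (inner ℂ f x).re + (inner ℂ a z).re := by
    intro x z
    rw [← hf, ← ha, ContinuousLinearMap.comp_apply, ContinuousLinearMap.comp_apply, ← map_add]
    simp
  have h1 := charFunDual_map_of_hasCircularLaw hχ (hG _ (hZG f))
    (L := L ∘SL ContinuousLinearMap.inl ℝ H ℂ)
    (by filter_upwards [hZ f] with ω h; rw [hf, h])
  have h2 := charFunDual_map_of_hasCircularLaw hy (hG _ (G.smul_mem (conj a) hYG))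
    (L := L ∘SL ContinuousLinearMap.inr ℝ H ℂ) (by
      filter_upwards [hY, Lp.coeFn_smul (conj a) Y] with ω h1 h2
      rw [ha, h2, Pi.smul_apply, h1, smul_eq_mul, RCLike.inner_apply, mul_comm])
  have h3 := charFunDual_map_of_hasCircularLaw (hχ.prodMk hy)
    (hG _ (G.add_mem (hZG f) (G.smul_mem (conj a) hYG))) (L := L) (by
      filter_upwards [hZ f, hY, Lp.coeFn_smul (conj a) Y, Lp.coeFn_add (Z f) (conj a • Y)]
        with ω h0 h1 h2 h3
      rw [hL, h3, Pi.add_apply, h2, Pi.smul_apply, h1, h0, smul_eq_mul, RCLike.inner_apply,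
        Complex.add_re, mul_comm])
  rw [h1, h2, h3, ← Complex.exp_add]
  congr 1
  have h4 := norm_add_sq_eq_norm_sq_add_norm_sq_of_inner_eq_zero (𝕜 := ℂ) (Z f) (conj a • Y)
    (by rw [inner_smul_right, ← inner_conj_symm, horth, map_zero, mul_zero])
  have h5 : ((‖Z f + conj a • Y‖ : ℂ)) ^ 2 = (‖Z f‖ : ℂ) ^ 2 + (‖conj a • Y‖ : ℂ) ^ 2 := by
    exact_mod_cast (by nlinarith :
      ‖Z f + conj a • Y‖ ^ 2 = ‖Z f‖ ^ 2 + ‖conj a • Y‖ ^ 2)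
  rw [h5]; ring

end CircularLaw

/-! ### Square integrable fields and their expansions -/

section HilbertField

variable {Ω : Type*} [MeasurableSpace Ω] {P : Measure Ω}
  {H : Type*} [NormedAddCommGroup H] [InnerProductSpace ℂ H]

theorem eLpNorm_two_sq {α F : Type*} [MeasurableSpace α] [NormedAddCommGroup F] (μ : Measure α)
    (f : α → F) : eLpNorm f 2 μ ^ 2 = ∫⁻ x, ‖f x‖ₑ ^ 2 ∂μ := by
  have := eLpNorm_nnreal_pow_eq_lintegral (f := f) (p := 2) (μ := μ) (by norm_num)
  simpa using this

/-- The conjugate-linear map `f ↦ ⟨f, Φ⟩` from the value space of a square integrable field to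
the square integrable variables. -/
noncomputable def coefficientMap (Φ : Lp H 2 P) : H →L⋆[ℂ] Lp ℂ 2 P :=
  LinearMap.mkContinuous
    { toFun := fun f => (innerSL ℂ f).compLp Φ
      map_add' := fun f g => by rw [map_add, ContinuousLinearMap.add_compLp]
      map_smul' := fun c f => by
        rw [map_smulₛₗ, ContinuousLinearMap.smul_compLp] } ‖Φ‖
    (fun f => by
      refine (ContinuousLinearMap.norm_compLp_le _ _).trans ?_
      rw [innerSL_apply_norm, mul_comm])

theorem coeFn_coefficientMap (Φ : Lp H 2 P) (f : H) :
    coefficientMap Φ f =ᵐ[P] fun ω => inner ℂ f (Φ ω) :=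
  ContinuousLinearMap.coeFn_compLp _ _

theorem coeFn_coefficientMap_toLp {φ : Ω → H} (hφ : MemLp φ 2 P) (f : H) :
    coefficientMap hφ.toLp f =ᵐ[P] fun ω => inner ℂ f (φ ω) := by
  filter_upwards [coeFn_coefficientMap hφ.toLp f, hφ.coeFn_toLp] with ω h1 h2
  rw [h1, h2]

/-- Coefficients of the remainder of an expansion `φ ≈ ∑ₙ ξₙ Ψₙ`. -/
theorem coeFn_coefficientMap_sub_sum {φ : Ω → H} (hφ : MemLp φ 2 P) (Ψ : ℕ → H)
    {X : ℕ → Lp ℂ 2 P} {ξ : ℕ → Ω → ℂ} (hξ : ∀ n, X n =ᵐ[P] ξ n) (g : H) (N : ℕ) :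
    (coefficientMap hφ.toLp g - ∑ n ∈ Finset.range N, inner ℂ g (Ψ n) • X n : Lp ℂ 2 P)
      =ᵐ[P] fun ω => inner ℂ g (φ ω - ∑ n ∈ Finset.range N, ξ n ω • Ψ n) := by
  have h1 : ∀ᵐ ω ∂P, ∀ n, (inner ℂ g (Ψ n) • X n : Lp ℂ 2 P) ω = inner ℂ g (Ψ n) * ξ n ω := by
    rw [ae_all_iff]
    intro n
    filter_upwards [Lp.coeFn_smul (inner ℂ g (Ψ n)) (X n), hξ n] with ω h1 h2
    rw [h1, Pi.smul_apply, h2, smul_eq_mul]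
  filter_upwards [h1, coeFn_coefficientMap_toLp hφ g, Lp.coeFn_sub (coefficientMap hφ.toLp g)
    (∑ n ∈ Finset.range N, inner ℂ g (Ψ n) • X n),
    Lp.coeFn_finsetSum (Finset.range N) fun n => inner ℂ g (Ψ n) • X n] with ω h1 h2 h3 h4
  rw [h3, Pi.sub_apply, h4, Finset.sum_apply, h2, inner_sub_right, inner_sum]
  congr 1
  refine Finset.sum_congr rfl fun n _ => ?_
  rw [h1, inner_smul_right, mul_comm]

theorem enorm_sq_eq_lintegral_of_ae {X : Lp ℂ 2 P} {x : Ω → ℂ} (h : X =ᵐ[P] x) :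
    ‖X‖ₑ ^ 2 = ∫⁻ ω, ‖x ω‖ₑ ^ 2 ∂P := by
  rw [Lp.enorm_def, eLpNorm_two_sq]
  refine lintegral_congr_ae ?_
  filter_upwards [h] with ω h
  rw [h]

theorem enorm_sq_eq_tsum {w : Set H} (b : HilbertBasis w ℂ H) (x : H) :
    ‖x‖ₑ ^ 2 = ∑' i, ‖inner ℂ (b i) x‖ₑ ^ 2 := by
  have h1 := b.hasSum_inner_mul_inner x x
  have h2 : HasSum (fun i => ‖inner ℂ (b i) x‖ ^ 2) (‖x‖ ^ 2) := by
    have h3 := Complex.hasSum_re h1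
    rw [inner_self_eq_norm_sq_to_K] at h3
    convert h3 using 1
    · ext i
      rw [← inner_conj_symm x (b i), RCLike.conj_mul]
      norm_cast
    · norm_cast
  have h3 : ∀ y : ℝ, 0 ≤ y → ENNReal.ofReal (y ^ 2) = ENNReal.ofReal y ^ 2 := fun y hy =>
    ENNReal.ofReal_pow hy 2
  rw [← ofReal_norm, ← h3 _ (norm_nonneg _), ← h2.tsum_eq,
    ENNReal.ofReal_tsum_of_nonneg (fun _ => by positivity) h2.summable]
  refine tsum_congr fun i => ?_
  rw [h3 _ (norm_nonneg _), ofReal_norm]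

variable [CompleteSpace H]

/-- A weakly measurable field with values in a separable Hilbert space is strongly measurable. -/
theorem aestronglyMeasurable_of_inner [SecondCountableTopology H] {φ : Ω → H}
    (h : ∀ f, AEStronglyMeasurable (fun ω => inner ℂ f (φ ω)) P) : AEStronglyMeasurable φ P := by
  obtain ⟨w, b, hw⟩ := exists_countable_hilbertBasis H
  have : Countable w := hw
  refine aestronglyMeasurable_of_tendsto_ae (u := (atTop : Filter (Finset w)))
    (f := fun s ω => ∑ i ∈ s, b.repr (φ ω) i • b i) (fun s => ?_)
    (ae_of_all _ fun ω => b.hasSum_repr (φ ω))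
  refine Finset.aestronglyMeasurable_fun_sum _ fun i _ => ?_
  simp only [b.repr_apply_apply]
  exact (h (b i)).smul_const (b i)

/-- A field all of whose complex functionals are Gaussian is Gaussian. -/
theorem hasGaussianLaw_of_inner [SecondCountableTopology H] [MeasurableSpace H] [BorelSpace H]
    {φ : Ω → H} (h : ∀ f, HasGaussianLaw (fun ω => inner ℂ f (φ ω)) P) : HasGaussianLaw φ P := by
  have hm : AEMeasurable φ P := (aestronglyMeasurable_of_inner fun f =>
    (h f).aemeasurable.aestronglyMeasurable).aemeasurable
  refine ⟨isGaussian_of_isGaussian_map fun L => ?_⟩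
  obtain ⟨f, hf⟩ := exists_eq_re_inner L
  rw [AEMeasurable.map_map_of_aemeasurable (by fun_prop) hm]
  have h1 : HasGaussianLaw (fun ω => Complex.reCLM (inner ℂ f (φ ω))) P := (h f).map_fun _
  have h2 : L ∘ φ = fun ω => Complex.reCLM (inner ℂ f (φ ω)) := funext fun ω => hf _
  rw [h2]
  exact h1.isGaussian_map

/-- Square integrability of a Gaussian field, by Fernique's theorem. -/
theorem memLp_two_of_inner_gaussian [SecondCountableTopology H] {φ : Ω → H}
    (h : ∀ f, HasGaussianLaw (fun ω => inner ℂ f (φ ω)) P) : MemLp φ 2 P := by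
  borelize H
  exact (hasGaussianLaw_of_inner h).memLp_two

/-- Expansion of a square integrable field along Gram-Schmidt coefficients: if the `T fₙ`,
`T f = ⟨f, φ⟩`, are orthonormal or zero and generate all the `T g`, then `φ = ∑ₙ ⟨fₙ, φ⟩ Ψₙ` in
mean square, where `Ψₙ` is the image of `fₙ` under the covariance operator. The convergence holds
coordinate by coordinate in a Hilbert basis, and Parseval's identity dominates the
coordinates. -/
theorem tendsto_lintegral_sub_expansion [SecondCountableTopology H] {φ : Ω → H}
    (hφ : MemLp φ 2 P) {f Ψ : ℕ → H}
    (horth : Pairwise fun i j =>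
      inner ℂ (coefficientMap hφ.toLp (f i)) (coefficientMap hφ.toLp (f j)) = 0)
    (hnorm : ∀ n, coefficientMap hφ.toLp (f n) = 0 ∨ ‖coefficientMap hφ.toLp (f n)‖ = 1)
    (hdense : ∀ g, coefficientMap hφ.toLp g ∈ closure
      (Submodule.span ℂ (Set.range fun n => coefficientMap hφ.toLp (f n)) : Set (Lp ℂ 2 P)))
    (hΨ : ∀ n g, inner ℂ (coefficientMap hφ.toLp (f n)) (coefficientMap hφ.toLp g)
      = inner ℂ g (Ψ n)) :
    Tendsto (fun N => ∫⁻ ω, ‖φ ω - ∑ n ∈ Finset.range N, inner ℂ (f n) (φ ω) • Ψ n‖ₑ ^ 2 ∂P)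
      atTop (𝓝 0) := by
  set T := coefficientMap hφ.toLp with hT
  have hTae : ∀ g, T g =ᵐ[P] fun ω => inner ℂ g (φ ω) := coeFn_coefficientMap_toLp hφ
  have ha : ∀ g n, inner ℂ (T (f n)) (T g) = inner ℂ g (Ψ n) * (‖T (f n)‖ : ℂ) ^ 2 := by
    intro g n
    rcases hnorm n with h | h
    · rw [h]; simp
    · rw [hΨ, h]; simp
  obtain ⟨w, b, hw⟩ := exists_countable_hilbertBasis H
  have : Countable w := hw
  set R : ℕ → w → Lp ℂ 2 P := fun N i =>
    T (b i) - ∑ n ∈ Finset.range N, inner ℂ (b i) (Ψ n) • T (f n) with hR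
  have hinner : ∀ g, AEStronglyMeasurable (fun ω => inner ℂ g (φ ω)) P := fun g =>
    (Lp.aestronglyMeasurable (T g)).congr (hTae g)
  have hRae : ∀ N i, R N i =ᵐ[P] fun ω =>
      inner ℂ (b i) (φ ω - ∑ n ∈ Finset.range N, inner ℂ (f n) (φ ω) • Ψ n) := by
    intro N i
    exact coeFn_coefficientMap_sub_sum hφ Ψ (fun n => hTae (f n)) (b i) N
  have hint : ∀ N, ∫⁻ ω, ‖φ ω - ∑ n ∈ Finset.range N, inner ℂ (f n) (φ ω) • Ψ n‖ₑ ^ 2 ∂P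
      = ∑' i, ‖R N i‖ₑ ^ 2 := by
    intro N
    simp_rw [enorm_sq_eq_tsum b]
    rw [lintegral_tsum]
    · exact tsum_congr fun i => (enorm_sq_eq_lintegral_of_ae (hRae N i)).symm
    · intro i
      exact ((Lp.aestronglyMeasurable (R N i)).congr (hRae N i)).enorm.pow_const 2
  have hfin : ∑' i, ‖T (b i)‖ₑ ^ 2 ≠ ∞ := by
    have : ∫⁻ ω, ‖φ ω‖ₑ ^ 2 ∂P = ∑' i, ‖T (b i)‖ₑ ^ 2 := by
      simp_rw [enorm_sq_eq_tsum b]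
      rw [lintegral_tsum fun i => (hinner (b i)).enorm.pow_const 2]
      exact tsum_congr fun i => (enorm_sq_eq_lintegral_of_ae (hTae (b i))).symm
    rw [← this, ← eLpNorm_two_sq]
    exact ENNReal.pow_ne_top hφ.2.ne
  simp_rw [hint]
  let _ : MeasurableSpace w := ⊤
  simp_rw [← lintegral_count]
  rw [← lintegral_count] at hfin
  have hlim := tendsto_lintegral_of_dominated_convergence (μ := (Measure.count : Measure w))
    (F := fun N i => ‖R N i‖ₑ ^ 2) (f := fun _ => 0) (fun i => ‖T (b i)‖ₑ ^ 2)
    (fun N => measurable_from_top) ?_ hfin ?_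
  · simpa using hlim
  · refine fun N => ae_of_all _ fun i => ?_
    have := norm_sub_orthogonal_expansion_le horth (ha (b i)) N (y := 0) (Submodule.zero_mem _)
    rw [sub_zero] at this
    have h2 : ‖R N i‖ₑ ≤ ‖T (b i)‖ₑ := by
      rw [← ofReal_norm, ← ofReal_norm]
      exact ENNReal.ofReal_le_ofReal this
    exact pow_le_pow_left' h2 2
  · refine ae_of_all _ fun i => ?_
    have h1 := tendsto_orthogonal_expansion horth (hdense (b i)) (ha (b i))
    have h2 : Tendsto (fun N => R N i) atTop (𝓝 0) := by
      have := (tendsto_const_nhds (x := T (b i))).sub h1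
      rwa [sub_self] at this
    have h3 : Tendsto (fun N => ‖R N i‖ₑ) atTop (𝓝 0) := by
      simpa [Function.comp_def] using (continuous_enorm.tendsto _).comp h2
    simpa using ENNReal.Tendsto.pow (n := 2) h3

end HilbertField

section IndependentSeries

variable {Ω : Type*} [MeasurableSpace Ω] {P : Measure Ω}

/-- An `L¹`-bounded series of independent centred real variables converges almost surely: its
partial sums form a martingale. -/
theorem ae_exists_tendsto_sum_of_iIndepFun [IsProbabilityMeasure P] {W : ℕ → Ω → ℝ}
    (hm : ∀ n, StronglyMeasurable (W n)) (hind : iIndepFun W P) (hint : ∀ n, Integrable (W n) P)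
    (h0 : ∀ n, ∫ ω, W n ω ∂P = 0) {R : NNReal}
    (hR : ∀ N, eLpNorm (fun ω => ∑ n ∈ Finset.range N, W n ω) 1 P ≤ R) :
    ∀ᵐ ω ∂P, ∃ l, Tendsto (fun N => ∑ n ∈ Finset.range N, W n ω) atTop (𝓝 l) := by
  set ℱ := Filtration.natural W hm
  -- The shift by one makes the partial sum measurable with respect to `W 0, …, W N`.
  set S : ℕ → Ω → ℝ := fun N ω => ∑ n ∈ Finset.range (N + 1), W n ω with hS
  have hadapt : StronglyAdapted ℱ S := by
    intro N
    refine Finset.stronglyMeasurable_fun_sum _ fun n hn => ?_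
    exact (Filtration.stronglyAdapted_natural hm n).mono
      (ℱ.mono (by simpa [Nat.lt_succ_iff] using hn))
  have hSint : ∀ N, Integrable (S N) P := fun N => integrable_finsetSum _ fun n _ => hint n
  have hmart : Martingale S ℱ P := by
    refine martingale_nat hadapt hSint fun N => ?_
    have h1 : S (N + 1) = S N + W (N + 1) := by
      ext ω
      simp only [hS, Pi.add_apply]
      rw [Finset.sum_range_succ]
    have h2 := condExp_add (hSint N) (hint (N + 1)) (ℱ N)
    have h3 := hind.condExp_natural_ae_eq_of_lt hm (Nat.lt_succ_self N)
    rw [h1]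
    filter_upwards [h2, h3] with ω h2 h3
    rw [h2, Pi.add_apply, h3, h0, add_zero,
      condExp_of_stronglyMeasurable (ℱ.le N) (hadapt N) (hSint N)]
  filter_upwards [hmart.submartingale.ae_tendsto_limitProcess fun N => hR (N + 1)] with ω hω
  exact ⟨_, (tendsto_add_atTop_iff_nat 1).1 hω⟩

/-- A series of independent centred complex variables which converges in `L²` converges almost
surely to the same limit. -/
theorem ae_tendsto_sum_of_tendsto_Lp [IsProbabilityMeasure P] {Z : ℕ → Ω → ℂ}
    {X : ℕ → Lp ℂ 2 P} (hX : ∀ n, X n =ᵐ[P] Z n) (hind : iIndepFun Z P)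
    (h0 : ∀ n, ∫ ω, Z n ω ∂P = 0) {Y : Lp ℂ 2 P}
    (hY : Tendsto (fun N => ∑ n ∈ Finset.range N, X n) atTop (𝓝 Y)) :
    ∀ᵐ ω ∂P, Tendsto (fun N => ∑ n ∈ Finset.range N, Z n ω) atTop (𝓝 (Y ω)) := by
  have hindX : iIndepFun (fun n => (X n : Ω → ℂ)) P := hind.congr fun n => (hX n).symm
  have hmX : ∀ n, StronglyMeasurable (X n) := fun n => Lp.stronglyMeasurable _
  have hiX : ∀ n, Integrable (X n) P := fun n => (Lp.memLp (X n)).integrable (by norm_num)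
  have h0X : ∀ n, ∫ ω, X n ω ∂P = 0 := fun n => by rw [integral_congr_ae (hX n), h0]
  have hsum : ∀ N, ((∑ n ∈ Finset.range N, X n : Lp ℂ 2 P) : Ω → ℂ)
      =ᵐ[P] fun ω => ∑ n ∈ Finset.range N, X n ω := by
    intro N
    filter_upwards [Lp.coeFn_finsetSum (Finset.range N) X] with ω h
    rw [h, Finset.sum_apply]
  obtain ⟨R, hR⟩ : ∃ R : NNReal, ∀ N,
      eLpNorm (fun ω => ∑ n ∈ Finset.range N, X n ω) 1 P ≤ R := by
    obtain ⟨r, hr⟩ := (Metric.isBounded_range_of_tendsto _ hY).exists_norm_le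
    refine ⟨r.toNNReal, fun N => ?_⟩
    rw [eLpNorm_congr_ae (hsum N).symm]
    refine (eLpNorm_le_eLpNorm_of_exponent_le (q := 2) (by norm_num)
      (Lp.aestronglyMeasurable _)).trans ?_
    rw [← Lp.enorm_def, ← ofReal_norm]
    exact ENNReal.ofReal_le_ofReal (hr _ ⟨N, rfl⟩)
  have part : ∀ p : ℂ →L[ℝ] ℝ, (∀ z, ‖p z‖ ≤ ‖z‖) →
      ∀ᵐ ω ∂P, ∃ l, Tendsto (fun N => p (∑ n ∈ Finset.range N, X n ω)) atTop (𝓝 l) := by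
    intro p hp
    have := ae_exists_tendsto_sum_of_iIndepFun (P := P) (W := fun n ω => p (X n ω)) (R := R)
      (fun n => p.continuous.comp_stronglyMeasurable (hmX n))
      (hindX.comp (fun _ => p) fun _ => p.continuous.measurable)
      (fun n => p.integrable_comp (hiX n))
      (fun n => by rw [p.integral_comp_comm (hiX n), h0X, map_zero]) (fun N => by
        refine (eLpNorm_mono fun ω => ?_).trans (hR N)
        rw [← map_sum]
        exact hp _)
    simpa only [map_sum] using this
  obtain ⟨ns, hns, hsub⟩ := (tendstoInMeasure_of_tendsto_Lp hY).exists_seq_tendsto_ae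
  filter_upwards [part Complex.reCLM fun z => Complex.abs_re_le_norm z,
    part Complex.imCLM fun z => Complex.abs_im_le_norm z, hsub, ae_all_iff.2 hsum,
    ae_all_iff.2 hX] with ω ⟨a, ha⟩ ⟨b, hb⟩ h1 h2 h3
  have h4 : Tendsto (fun N => ∑ n ∈ Finset.range N, X n ω) atTop (𝓝 (a + b * Complex.I)) := by
    have h5 := ((Complex.continuous_ofReal.tendsto a).comp ha).add
      (((Complex.continuous_ofReal.tendsto b).comp hb).mul_const Complex.I)
    refine h5.congr fun N => ?_
    exact Complex.re_add_im _
  have h5 : Tendsto (fun i => ∑ n ∈ Finset.range (ns i), X n ω) atTop (𝓝 (Y ω)) :=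
    h1.congr fun i => h2 (ns i)
  rw [← tendsto_nhds_unique (h4.comp hns.tendsto_atTop) h5]
  exact h4.congr fun N => Finset.sum_congr rfl fun n _ => h3 n

end IndependentSeries

/-! ### The phase of a circular variable -/

section Phase

/-- The argument of a complex number, taken in `[0, 2π)`. -/
noncomputable def phase (z : ℂ) : ℝ := toIcoMod Real.two_pi_pos 0 z.arg

theorem phase_mem_Ico (z : ℂ) : phase z ∈ Set.Ico 0 (2 * Real.pi) := by
  simpa [phase] using toIcoMod_mem_Ico Real.two_pi_pos 0 z.arg

theorem norm_mul_exp_phase_mul_I (z : ℂ) :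
    (‖z‖ : ℂ) * Complex.exp (phase z * Complex.I) = z := by
  conv_rhs => rw [← Complex.norm_mul_exp_arg_mul_I z]
  congr 1
  rw [phase, toIcoMod, zsmul_eq_mul]
  push_cast
  rw [sub_mul, Complex.exp_sub, mul_assoc, Complex.exp_int_mul_two_pi_mul_I, div_one]

theorem measurable_phase : Measurable phase := by
  have : Fact (0 < 2 * Real.pi) := ⟨Real.two_pi_pos⟩
  exact measurable_subtype_coe.comp ((AddCircle.measurableEquivIco (2 * Real.pi) 0).measurable.comp
    (AddCircle.measurable_mk'.comp Complex.measurable_arg))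

/-- Counterpart for `equivIco` of `AddCircle.measurePreserving_equivIoc`, on the real line. -/
theorem map_equivIco_volume (T : ℝ) [hT : Fact (0 < T)] :
    (volume : Measure (AddCircle T)).map (fun x => (AddCircle.equivIco T 0 x : ℝ))
      = volume.restrict (Set.Ico 0 T) := by
  have hm : Measurable fun x : AddCircle T => (AddCircle.equivIco T 0 x : ℝ) :=
    measurable_subtype_coe.comp (AddCircle.measurableEquivIco T 0).measurable
  have hmk := AddCircle.measurePreserving_mk T 0
  have hI : (volume : Measure ℝ).restrict (Set.Ioc 0 (0 + T)) = volume.restrict (Set.Ico 0 T) := by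
    rw [zero_add, restrict_Ico_eq_restrict_Ioc]
  rw [← hmk.map_eq, Measure.map_map hm hmk.measurable, hI]
  conv_rhs => rw [← Measure.map_id (μ := volume.restrict (Set.Ico 0 T))]
  refine Measure.map_congr ?_
  filter_upwards [ae_restrict_mem measurableSet_Ico] with x hx
  exact (toIcoMod_eq_self hT.out).2 (by simpa using hx)

/-- The phase of a rotation invariant law without atom at `0` is uniform: the induced law on the
circle is translation invariant, hence a multiple of the Haar measure. -/
theorem map_phase_eq_uniform {ν : Measure ℂ} [IsProbabilityMeasure ν] (h0 : ν {0} = 0)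
    (hrot : ∀ t : ℝ, ν.map (fun z => Complex.exp (t * Complex.I) * z) = ν) :
    ν.map phase = ProbabilityTheory.cond volume (Set.Ico 0 (2 * Real.pi)) := by
  have : Fact (0 < 2 * Real.pi) := ⟨Real.two_pi_pos⟩
  set q : ℂ → AddCircle (2 * Real.pi) := fun z => (z.arg : AddCircle (2 * Real.pi)) with hq
  have hqm : Measurable q := AddCircle.measurable_mk'.comp Complex.measurable_arg
  have hne : ∀ᵐ z ∂ν, z ≠ 0 := by
    rw [ae_iff]; simpa using h0
  have hinv : (ν.map q).IsAddLeftInvariant := by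
    refine ⟨fun a => ?_⟩
    obtain ⟨t, rfl⟩ := QuotientAddGroup.mk_surjective a
    rw [Measure.map_map (measurable_const_add _) hqm]
    conv_rhs => rw [← hrot t, Measure.map_map hqm (by fun_prop)]
    refine Measure.map_congr ?_
    filter_upwards [hne] with z hz
    have := Complex.arg_mul_coe_angle (Complex.exp_ne_zero (t * Complex.I)) hz
    have h2 : ((Complex.exp (t * Complex.I)).arg : Real.Angle) = (t : Real.Angle) := by
      rw [Complex.arg_exp_mul_I]
      exact Real.Angle.coe_toIocMod _ _
    rw [h2] at this
    exact this.symm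
  have : IsProbabilityMeasure (ν.map q) := Measure.isProbabilityMeasure_map hqm.aemeasurable
  have hq := Measure.isAddLeftInvariant_eq_smul (ν.map q) volume
  set c := (ν.map q).addHaarScalarFactor volume
  have hm : Measurable fun x : AddCircle (2 * Real.pi) =>
      (AddCircle.equivIco (2 * Real.pi) 0 x : ℝ) :=
    measurable_subtype_coe.comp (AddCircle.measurableEquivIco (2 * Real.pi) 0).measurable
  have h1 : ν.map phase = c • volume.restrict (Set.Ico 0 (2 * Real.pi)) := by
    rw [← map_equivIco_volume, ← Measure.map_smul, ← hq, Measure.map_map hm hqm]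
    rfl
  have hc : (c : ℝ≥0∞) * volume (Set.Ico 0 (2 * Real.pi)) = 1 := by
    have : IsProbabilityMeasure (ν.map phase) :=
      Measure.isProbabilityMeasure_map measurable_phase.aemeasurable
    have h2 := measure_univ (μ := ν.map phase)
    rw [h1, Measure.smul_apply, Measure.restrict_apply_univ] at h2
    exact h2
  rw [h1, ProbabilityTheory.cond, ← ENNReal.eq_inv_of_mul_eq_one_left hc]
  rfl

end Phase

section CircularLaw

variable {Ω : Type*} [MeasurableSpace Ω] {P : Measure Ω}

theorem charFun_map_of_hasCircularLaw {Y : Lp ℂ 2 P} (hY : ∀ a : ℂ, HasCircularLaw (a • Y))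
    {y : Ω → ℂ} (h : Y =ᵐ[P] y) (t : ℂ) :
    charFun (P.map y) t = Complex.exp (-(‖t‖ * ‖Y‖) ^ 2 / 4) := by
  have hy : AEMeasurable y P := ((Lp.aestronglyMeasurable Y).congr h).aemeasurable
  rw [charFun_apply, integral_map hy (by fun_prop)]
  have h1 := hY (conj t)
  rw [HasCircularLaw, norm_smul, RCLike.norm_conj] at h1
  push_cast at h1
  rw [← h1]
  refine integral_congr_ae ?_
  filter_upwards [h, Lp.coeFn_smul (conj t) Y] with ω h1 h2
  rw [h2, Pi.smul_apply, h1, Complex.inner]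
  simp [mul_comm]

variable [IsProbabilityMeasure P] {Y : Lp ℂ 2 P} (hY : ∀ a : ℂ, HasCircularLaw (a • Y))
  {y : Ω → ℂ} (h : Y =ᵐ[P] y)

include hY h

/-- The law of a circular variable is invariant under rotations. -/
theorem map_rotation_of_hasCircularLaw (t : ℝ) :
    (P.map y).map (fun z => Complex.exp (t * Complex.I) * z) = P.map y := by
  have hy : AEMeasurable y P := ((Lp.aestronglyMeasurable Y).congr h).aemeasurable
  have : IsProbabilityMeasure (P.map y) := Measure.isProbabilityMeasure_map hy
  have hm : Measurable fun z => Complex.exp (t * Complex.I) * z := by fun_prop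
  have : IsProbabilityMeasure ((P.map y).map fun z => Complex.exp (t * Complex.I) * z) :=
    Measure.isProbabilityMeasure_map hm.aemeasurable
  refine Measure.ext_of_charFun ?_
  ext s
  have h1 : charFun ((P.map y).map fun z => Complex.exp (t * Complex.I) * z) s
      = charFun (P.map y) (conj (Complex.exp (t * Complex.I)) * s) := by
    rw [charFun_apply, charFun_apply, integral_map hm.aemeasurable (by fun_prop)]
    congr 1
    ext z
    rw [Complex.inner, Complex.inner]
    simp only [map_mul]
    congr 4
    ring
  rw [h1, charFun_map_of_hasCircularLaw hY h, charFun_map_of_hasCircularLaw hY h, norm_mul,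
    RCLike.norm_conj, Complex.norm_exp_ofReal_mul_I, one_mul]

theorem map_re_of_hasCircularLaw :
    P.map (fun ω => (y ω).re) = gaussianReal 0 (‖Y‖ ^ 2 / 2).toNNReal := by
  have hy : AEMeasurable y P := ((Lp.aestronglyMeasurable Y).congr h).aemeasurable
  have hre : AEMeasurable (fun ω => (y ω).re) P := Complex.measurable_re.comp_aemeasurable hy
  have : IsProbabilityMeasure (P.map fun ω => (y ω).re) := Measure.isProbabilityMeasure_map hre
  refine Measure.ext_of_charFun ?_
  ext s
  have h1 := charFun_map_of_hasCircularLaw hY h (s : ℂ)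
  rw [charFun_apply, integral_map hy (by fun_prop)] at h1
  rw [charFun_gaussianReal, charFun_apply, integral_map hre (by fun_prop)]
  have h2 : ∀ ω, inner ℝ (y ω).re s = inner ℝ (y ω) (s : ℂ) := by
    intro ω
    rw [Complex.inner]
    simp [mul_comm]
  simp_rw [h2]
  rw [h1, Real.coe_toNNReal _ (by positivity)]
  congr 1
  have h3 : ((‖(s : ℂ)‖ : ℂ)) ^ 2 = (s : ℂ) ^ 2 := by
    rw [Complex.norm_real, Real.norm_eq_abs]
    exact_mod_cast sq_abs s
  rw [mul_pow, h3]
  push_cast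
  ring

theorem measure_eq_zero_of_hasCircularLaw (hpos : Y ≠ 0) : P {ω | y ω = 0} = 0 := by
  have hy : AEMeasurable y P := ((Lp.aestronglyMeasurable Y).congr h).aemeasurable
  have hre : AEMeasurable (fun ω => (y ω).re) P := Complex.measurable_re.comp_aemeasurable hy
  have hv : (‖Y‖ ^ 2 / 2).toNNReal ≠ 0 := by
    have := norm_pos_iff.2 hpos
    simp; positivity
  have := nullSingletonClass_gaussianReal (μ := 0) hv
  have h0 : P.map (fun ω => (y ω).re) {0} = 0 := by
    rw [map_re_of_hasCircularLaw hY h, measure_singleton]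
  rw [Measure.map_apply_of_aemeasurable hre (measurableSet_singleton 0)] at h0
  refine measure_mono_null (fun ω hω => ?_) h0
  have : y ω = 0 := hω
  simp [this]

/-- A nondegenerate circular variable exceeds every level with positive probability. -/
theorem measure_lt_norm_sq_ne_zero (hpos : Y ≠ 0) (u : ℝ) : P {ω | u < ‖y ω‖ ^ 2} ≠ 0 := by
  have hy : AEMeasurable y P := ((Lp.aestronglyMeasurable Y).congr h).aemeasurable
  have hre : AEMeasurable (fun ω => (y ω).re) P := Complex.measurable_re.comp_aemeasurable hy
  have hv : (‖Y‖ ^ 2 / 2).toNNReal ≠ 0 := by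
    have := norm_pos_iff.2 hpos
    simp; positivity
  intro h0
  have h1 : P.map (fun ω => (y ω).re) (Set.Ioi (|u| + 1)) = 0 := by
    rw [Measure.map_apply_of_aemeasurable hre measurableSet_Ioi]
    refine measure_mono_null (fun ω hω => ?_) h0
    have h2 : |u| + 1 < (y ω).re := hω
    have h3 := Complex.abs_re_le_norm (y ω)
    have h4 : |u| + 1 < ‖y ω‖ := h2.trans_le ((le_abs_self _).trans h3)
    have h5 := le_abs_self u
    have h6 := abs_nonneg u
    change u < ‖y ω‖ ^ 2
    nlinarith
  rw [map_re_of_hasCircularLaw hY h] at h1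
  have h2 := gaussianReal_absolutelyContinuous' 0 hv h1
  simp at h2

/-- The phase of a nondegenerate circular variable is uniform, also conditionally on an event
which depends on the modulus only. -/
theorem isUniform_phase_cond (hpos : Y ≠ 0) (hy : Measurable y) {s : Set ℝ}
    (hs : MeasurableSet s) (hsP : P {ω | ‖y ω‖ ∈ s} ≠ 0) :
    pdf.IsUniform (fun ω => phase (y ω)) (Set.Ico 0 (2 * Real.pi)) P[|{ω | ‖y ω‖ ∈ s}] := by
  set A : Set Ω := {ω | ‖y ω‖ ∈ s} with hA
  have hAm : MeasurableSet A := hy.norm hs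
  have : IsProbabilityMeasure P[|A] := cond_isProbabilityMeasure hsP
  have hν : IsProbabilityMeasure (P[|A].map y) :=
    Measure.isProbabilityMeasure_map hy.aemeasurable
  have h0 : P[|A].map y {0} = 0 := by
    rw [Measure.map_apply hy (measurableSet_singleton 0)]
    exact cond_absolutelyContinuous (measure_eq_zero_of_hasCircularLaw hY h hpos)
  have hrot : ∀ t : ℝ, (P[|A].map y).map (fun z => Complex.exp (t * Complex.I) * z)
      = P[|A].map y := by
    intro t
    have hm : Measurable fun z => Complex.exp (t * Complex.I) * z := by fun_prop
    have hsm : MeasurableSet {z : ℂ | ‖z‖ ∈ s} := measurable_norm hs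
    ext B hB
    rw [Measure.map_apply hm hB, Measure.map_apply hy (hm hB), Measure.map_apply hy hB,
      cond_apply hAm, cond_apply hAm]
    congr 1
    have h1 : A ∩ y ⁻¹' ((fun z => Complex.exp (t * Complex.I) * z) ⁻¹' B)
        = y ⁻¹' ((fun z => Complex.exp (t * Complex.I) * z) ⁻¹' ({z : ℂ | ‖z‖ ∈ s} ∩ B)) := by
      ext ω
      simp [hA, Complex.norm_exp_ofReal_mul_I]
    rw [h1, ← Measure.map_apply hy (hm (hsm.inter hB)),
      ← Measure.map_apply hm (hsm.inter hB), map_rotation_of_hasCircularLaw hY h,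
      Measure.map_apply hy (hsm.inter hB)]
    rfl
  rw [pdf.IsUniform, ← map_phase_eq_uniform h0 hrot, Measure.map_map measurable_phase hy]
  rfl

end CircularLaw

/-! ### Local averages and the covariance operator -/

section Domain

variable {d : ℕ} {Λ : Set (EuclideanSpace ℝ (Fin d))}

theorem isFiniteMeasure_restrict_of_isBounded (hΛ : Bornology.IsBounded Λ) :
    IsFiniteMeasure ((volume : Measure (EuclideanSpace ℝ (Fin d))).restrict Λ) :=
  ⟨by rw [Measure.restrict_apply_univ]; exact hΛ.measure_lt_top⟩

theorem memLp_of_continuousOn (hΛ_closed : IsClosed Λ) (hΛ_bdd : Bornology.IsBounded Λ)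
    {F : EuclideanSpace ℝ (Fin d) → ℂ} (hF : ContinuousOn F Λ) (p : ℝ≥0∞) :
    MemLp F p (volume.restrict Λ) := by
  have := isFiniteMeasure_restrict_of_isBounded hΛ_bdd
  obtain ⟨M, hM⟩ :=
    (Metric.isCompact_of_isClosed_isBounded hΛ_closed hΛ_bdd).exists_bound_of_continuousOn hF
  refine MemLp.of_bound (hF.aestronglyMeasurable hΛ_closed.measurableSet) M ?_
  filter_upwards [ae_restrict_mem hΛ_closed.measurableSet] with x hx using hM x hx

theorem integrable_of_continuousOn (hΛ_closed : IsClosed Λ) (hΛ_bdd : Bornology.IsBounded Λ)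
    {F : EuclideanSpace ℝ (Fin d) → ℂ} (hF : ContinuousOn F Λ) :
    Integrable F (volume.restrict Λ) :=
  memLp_one_iff_integrable.1 (memLp_of_continuousOn hΛ_closed hΛ_bdd hF 1)

theorem restrict_ball_ne_zero (hΛ_vol : ∀ r > 0, 0 < volume (Λ ∩ Metric.ball 0 r)) {r : ℝ}
    (hr : 0 < r) : volume.restrict Λ (Metric.ball 0 r) ≠ 0 := by
  rw [Measure.restrict_apply measurableSet_ball, Set.inter_comm]
  exact (hΛ_vol r hr).ne'

theorem restrict_ne_top (hΛ_bdd : Bornology.IsBounded Λ) (s : Set (EuclideanSpace ℝ (Fin d))) :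
    volume.restrict Λ s ≠ ∞ := by
  have := isFiniteMeasure_restrict_of_isBounded hΛ_bdd
  exact measure_ne_top _ _

theorem norm_setAverage_ball_sub_le (hΛ_closed : IsClosed Λ) (hΛ_bdd : Bornology.IsBounded Λ)
    (hΛ_vol : ∀ r > 0, 0 < volume (Λ ∩ Metric.ball 0 r))
    {F : EuclideanSpace ℝ (Fin d) → ℂ} (hF : Integrable F (volume.restrict Λ)) {r : ℝ}
    (hr : 0 < r) {z : ℂ} {ε : ℝ} (h : ∀ x ∈ Λ, x ∈ Metric.ball 0 r → ‖F x - z‖ ≤ ε) :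
    ‖(⨍ x in Metric.ball 0 r, F x ∂(volume.restrict Λ)) - z‖ ≤ ε := by
  rw [← dist_eq_norm, ← Metric.mem_closedBall]
  refine (convex_closedBall z ε).set_average_mem Metric.isClosed_closedBall
    (restrict_ball_ne_zero hΛ_vol hr) (restrict_ne_top hΛ_bdd _) ?_ hF.integrableOn
  rw [Measure.restrict_restrict measurableSet_ball]
  filter_upwards [ae_restrict_mem (measurableSet_ball.inter hΛ_closed.measurableSet)] with x hx
  rw [Metric.mem_closedBall, dist_eq_norm]
  exact h x hx.2 hx.1

/-- Averages over small balls recover the value at `0` of a function continuous at `0`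
relative to `Λ`. -/
theorem tendsto_setAverage_ball (hΛ_closed : IsClosed Λ) (hΛ_bdd : Bornology.IsBounded Λ)
    (hΛ_vol : ∀ r > 0, 0 < volume (Λ ∩ Metric.ball 0 r))
    {F : EuclideanSpace ℝ (Fin d) → ℂ} (hF : Integrable F (volume.restrict Λ))
    (hc : ContinuousWithinAt F Λ 0) :
    Tendsto (fun k : ℕ => ⨍ x in Metric.ball 0 (1 / ((k : ℝ) + 1)), F x ∂(volume.restrict Λ))
      atTop (𝓝 (F 0)) := by
  rw [Metric.tendsto_atTop]
  intro ε hε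
  obtain ⟨δ, hδ, h⟩ := Metric.continuousWithinAt_iff.1 hc (ε / 2) (by positivity)
  obtain ⟨N, hN⟩ := exists_nat_one_div_lt hδ
  refine ⟨N, fun k hk => ?_⟩
  rw [dist_eq_norm]
  refine (norm_setAverage_ball_sub_le hΛ_closed hΛ_bdd hΛ_vol hF Nat.one_div_pos_of_nat
    (ε := ε / 2) fun x hx hxk => ?_).trans_lt (by linarith)
  rw [← dist_eq_norm]
  refine (h hx ?_).le
  exact (Metric.mem_ball.1 hxk).trans_le ((Nat.one_div_le_one_div hk).trans hN.le)

/-- The normalised indicator function of the ball of radius `1 / (k + 1)` around `0`, as an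
element of `L²(Λ; ℂ)`. -/
noncomputable def ballAverage (hΛ_bdd : Bornology.IsBounded Λ) (k : ℕ) : FieldSpace Λ :=
  indicatorConstLp 2 (measurableSet_ball (x := 0) (ε := 1 / ((k : ℝ) + 1)))
    (restrict_ne_top hΛ_bdd _)
    (((volume.restrict Λ).real (Metric.ball 0 (1 / ((k : ℝ) + 1))) : ℂ)⁻¹)

theorem inner_ballAverage (hΛ_bdd : Bornology.IsBounded Λ) (k : ℕ) (F : FieldSpace Λ) :
    inner ℂ (ballAverage hΛ_bdd k) F
      = ⨍ x in Metric.ball 0 (1 / ((k : ℝ) + 1)), F x ∂(volume.restrict Λ) := by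
  rw [ballAverage, L2.inner_indicatorConstLp_eq_inner_setIntegral, setAverage_eq,
    RCLike.inner_apply, map_inv₀, Complex.conj_ofReal, Complex.real_smul, mul_comm,
    Complex.ofReal_inv]

theorem integral_mul_ballAverage (hΛ_bdd : Bornology.IsBounded Λ) (k : ℕ)
    (F : EuclideanSpace ℝ (Fin d) → ℂ) :
    ∫ y in Λ, F y * ballAverage hΛ_bdd k y
      = ⨍ x in Metric.ball 0 (1 / ((k : ℝ) + 1)), F x ∂(volume.restrict Λ) := by
  rw [setAverage_eq, ← integral_indicator measurableSet_ball, ← integral_smul]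
  refine integral_congr_ae ?_
  filter_upwards [indicatorConstLp_coeFn (p := 2)
    (hs := measurableSet_ball (x := (0 : EuclideanSpace ℝ (Fin d))) (ε := 1 / ((k : ℝ) + 1)))
    (hμs := restrict_ne_top hΛ_bdd _)
    (c := ((volume.restrict Λ).real (Metric.ball 0 (1 / ((k : ℝ) + 1))) : ℂ)⁻¹)] with x hx
  rw [ballAverage, hx]
  by_cases h : x ∈ Metric.ball (0 : EuclideanSpace ℝ (Fin d)) (1 / ((k : ℝ) + 1))
  · rw [Set.indicator_of_mem h, Set.indicator_of_mem h, Complex.real_smul, mul_comm,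
      Complex.ofReal_inv]
  · rw [Set.indicator_of_notMem h, Set.indicator_of_notMem h, mul_zero, smul_zero]

theorem integrable_fieldSpace (hΛ_bdd : Bornology.IsBounded Λ) (g : FieldSpace Λ) :
    Integrable g (volume.restrict Λ) := by
  have := isFiniteMeasure_restrict_of_isBounded hΛ_bdd
  exact (Lp.memLp g).integrable (by norm_num)

end Domain

section Covariance

variable {d : ℕ} {Λ : Set (EuclideanSpace ℝ (Fin d))} {C : EuclideanSpace ℝ (Fin d) → ℂ}

/-- The covariance operator `(Ĉ g)(x) = ∫_Λ C (x - y) g(y) dy`, with values in functions. -/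
noncomputable def kernelOperator (Λ : Set (EuclideanSpace ℝ (Fin d)))
    (C : EuclideanSpace ℝ (Fin d) → ℂ) (g : FieldSpace Λ) (x : EuclideanSpace ℝ (Fin d)) : ℂ :=
  ∫ y in Λ, C (x - y) * g y

theorem continuousOn_translate (hC_cont : ContinuousOn
      (fun p : EuclideanSpace ℝ (Fin d) × EuclideanSpace ℝ (Fin d) => C (p.1 - p.2)) (Λ ×ˢ Λ))
    {x : EuclideanSpace ℝ (Fin d)} (hx : x ∈ Λ) : ContinuousOn (fun y => C (x - y)) Λ :=
  hC_cont.comp (f := fun y => (x, y)) (by fun_prop) fun _ hy => ⟨hx, hy⟩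

theorem continuousOn_of_zero_mem (hΛ_zero : 0 ∈ Λ) (hC_cont : ContinuousOn
      (fun p : EuclideanSpace ℝ (Fin d) × EuclideanSpace ℝ (Fin d) => C (p.1 - p.2)) (Λ ×ˢ Λ)) :
    ContinuousOn C Λ := by
  have := hC_cont.comp (f := fun y => (y, (0 : EuclideanSpace ℝ (Fin d)))) (s := Λ) (by fun_prop)
    fun _ hy => ⟨hy, hΛ_zero⟩
  simpa [Function.comp_def] using this

theorem exists_bound_covariance (hΛ_closed : IsClosed Λ) (hΛ_bdd : Bornology.IsBounded Λ)
    (hC_cont : ContinuousOn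
      (fun p : EuclideanSpace ℝ (Fin d) × EuclideanSpace ℝ (Fin d) => C (p.1 - p.2)) (Λ ×ˢ Λ)) :
    ∃ M, ∀ x ∈ Λ, ∀ y ∈ Λ, ‖C (x - y)‖ ≤ M := by
  have hc := Metric.isCompact_of_isClosed_isBounded hΛ_closed hΛ_bdd
  obtain ⟨M, hM⟩ := (hc.prod hc).exists_bound_of_continuousOn hC_cont
  exact ⟨M, fun x hx y hy => hM (x, y) ⟨hx, hy⟩⟩

theorem continuousOn_kernelOperator (hΛ_closed : IsClosed Λ)
    (hΛ_bdd : Bornology.IsBounded Λ) (hC_cont : ContinuousOn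
      (fun p : EuclideanSpace ℝ (Fin d) × EuclideanSpace ℝ (Fin d) => C (p.1 - p.2)) (Λ ×ˢ Λ))
    (g : FieldSpace Λ) : ContinuousOn (kernelOperator Λ C g) Λ := by
  obtain ⟨M, hM⟩ := exists_bound_covariance hΛ_closed hΛ_bdd hC_cont
  have hg := integrable_fieldSpace hΛ_bdd g
  refine continuousOn_of_dominated (bound := fun y => M * ‖g y‖) (fun x hx => ?_) (fun x hx => ?_)
    (hg.norm.const_mul M) ?_
  · exact ((continuousOn_translate hC_cont hx).aestronglyMeasurable
      hΛ_closed.measurableSet).mul hg.1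
  · filter_upwards [ae_restrict_mem hΛ_closed.measurableSet] with y hy
    rw [norm_mul]
    exact mul_le_mul_of_nonneg_right (hM x hx y hy) (norm_nonneg _)
  · filter_upwards [ae_restrict_mem hΛ_closed.measurableSet] with y hy
    refine ContinuousOn.mul ?_ continuousOn_const
    exact hC_cont.comp (f := fun x => (x, y)) (by fun_prop) fun _ hx => ⟨hx, hy⟩

theorem inner_toLp {F : EuclideanSpace ℝ (Fin d) → ℂ} (hF : MemLp F 2 (volume.restrict Λ))
    (g : FieldSpace Λ) : inner ℂ g hF.toLp = ∫ x in Λ, conj (g x) * F x := by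
  rw [L2.inner_def]
  refine integral_congr_ae ?_
  filter_upwards [hF.coeFn_toLp] with x hx
  rw [hx, RCLike.inner_apply, mul_comm]

variable {Ω : Type*} [MeasurableSpace Ω] {P : Measure Ω} {φ : Ω → FieldSpace Λ}

instance : SecondCountableTopology (FieldSpace Λ) := by
  have : Fact ((2 : ℝ≥0∞) ≠ ∞) := ⟨by simp⟩
  infer_instance

theorem IsHomogeneousGaussianField.memLp (hφ : IsHomogeneousGaussianField Λ C φ P) :
    MemLp φ 2 P :=
  memLp_two_of_inner_gaussian fun f => (hφ.gaussian f).hasGaussianLaw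

/-- The covariance condition in terms of the coefficients `T f = ⟨f, φ⟩`. -/
theorem IsHomogeneousGaussianField.inner_coefficientMap
    (hφ : IsHomogeneousGaussianField Λ C φ P) (f g : FieldSpace Λ) :
    inner ℂ (coefficientMap hφ.memLp.toLp f) (coefficientMap hφ.memLp.toLp g)
      = ∫ x in Λ, conj (g x) * kernelOperator Λ C f x := by
  rw [L2.inner_def]
  refine Eq.trans ?_ (hφ.covariance g f)
  refine integral_congr_ae ?_
  filter_upwards [coeFn_coefficientMap_toLp hφ.memLp f, coeFn_coefficientMap_toLp hφ.memLp g]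
    with ω h1 h2
  rw [h1, h2, RCLike.inner_apply, inner_conj_symm]

/-- The coefficients `⟨f, φ⟩` and their `L²` limits are jointly circular Gaussian. -/
theorem IsHomogeneousGaussianField.hasCircularLaw [IsProbabilityMeasure P]
    (hφ : IsHomogeneousGaussianField Λ C φ P) :
    ∀ X ∈ (LinearMap.range (coefficientMap hφ.memLp.toLp).toLinearMap).topologicalClosure,
      HasCircularLaw X := by
  intro X hX
  refine closure_minimal ?_ isClosed_hasCircularLaw hX
  rintro _ ⟨f, rfl⟩
  exact (hφ.gaussian f).hasCircularLaw (coeFn_coefficientMap_toLp hφ.memLp f)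

variable (hΛ_closed : IsClosed Λ) (hΛ_bdd : Bornology.IsBounded Λ) (hΛ_zero : 0 ∈ Λ)
  (hΛ_vol : ∀ r > 0, 0 < volume (Λ ∩ Metric.ball 0 r))
  (hC_cont : ContinuousOn
    (fun p : EuclideanSpace ℝ (Fin d) × EuclideanSpace ℝ (Fin d) => C (p.1 - p.2)) (Λ ×ˢ Λ))

include hΛ_closed hΛ_bdd hC_cont

theorem IsHomogeneousGaussianField.inner_coefficientMap_ballAverage
    (hφ : IsHomogeneousGaussianField Λ C φ P) (f : FieldSpace Λ) (k : ℕ) :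
    inner ℂ (coefficientMap hφ.memLp.toLp f) (coefficientMap hφ.memLp.toLp (ballAverage hΛ_bdd k))
      = ⨍ x in Metric.ball 0 (1 / ((k : ℝ) + 1)), kernelOperator Λ C f x
          ∂(volume.restrict Λ) := by
  have hF := memLp_of_continuousOn hΛ_closed hΛ_bdd
    (continuousOn_kernelOperator hΛ_closed hΛ_bdd hC_cont f) 2
  rw [hφ.inner_coefficientMap, ← inner_toLp hF, inner_ballAverage]
  refine setAverage_congr_fun measurableSet_ball ?_
  filter_upwards [hF.coeFn_toLp] with x hx _ using hx

include hΛ_vol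

theorem tendsto_kernelOperator_ballAverage {x : EuclideanSpace ℝ (Fin d)} (hx : x ∈ Λ)
    (hΛ_zero : 0 ∈ Λ) :
    Tendsto (fun k => kernelOperator Λ C (ballAverage hΛ_bdd k) x) atTop (𝓝 (C x)) := by
  have hc := continuousOn_translate hC_cont hx
  have := tendsto_setAverage_ball hΛ_closed hΛ_bdd hΛ_vol
    (integrable_of_continuousOn hΛ_closed hΛ_bdd hc) (hc 0 hΛ_zero)
  simp only [sub_zero] at this
  exact this.congr fun k => (integral_mul_ballAverage hΛ_bdd k _).symm

include hΛ_zero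

/-- The local averages of the field around `0` form a Cauchy sequence in mean square, because
their covariances converge to `C 0`. -/
theorem IsHomogeneousGaussianField.exists_tendsto_ballAverage
    (hφ : IsHomogeneousGaussianField Λ C φ P) :
    ∃ Y : Lp ℂ 2 P,
      Tendsto (fun k => coefficientMap hφ.memLp.toLp (ballAverage hΛ_bdd k)) atTop (𝓝 Y) ∧
      ((‖Y‖ : ℂ)) ^ 2 = C 0 := by
  set X : ℕ → Lp ℂ 2 P := fun k => coefficientMap hφ.memLp.toLp (ballAverage hΛ_bdd k) with hX
  have key : ∀ ε > 0, ∃ N, ∀ k ≥ N, ∀ l ≥ N, ‖inner ℂ (X k) (X l) - C 0‖ ≤ ε := by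
    intro ε hε
    have h0 := hC_cont (0, 0) ⟨hΛ_zero, hΛ_zero⟩
    obtain ⟨δ, hδ, h⟩ := Metric.continuousWithinAt_iff.1 h0 ε hε
    obtain ⟨N, hN⟩ := exists_nat_one_div_lt hδ
    refine ⟨N, fun k hk l hl => ?_⟩
    rw [hX, hφ.inner_coefficientMap_ballAverage hΛ_closed hΛ_bdd hC_cont]
    have hsmall : ∀ m ≥ N, ∀ x ∈ Metric.ball (0 : EuclideanSpace ℝ (Fin d)) (1 / ((m : ℝ) + 1)),
        dist x 0 < δ := fun m hm x hx =>
      (Metric.mem_ball.1 hx).trans_le ((Nat.one_div_le_one_div hm).trans hN.le)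
    refine norm_setAverage_ball_sub_le hΛ_closed hΛ_bdd hΛ_vol
      (integrable_of_continuousOn hΛ_closed hΛ_bdd
        (continuousOn_kernelOperator hΛ_closed hΛ_bdd hC_cont _))
      Nat.one_div_pos_of_nat fun x hx hxl => ?_
    rw [kernelOperator, integral_mul_ballAverage hΛ_bdd k fun y => C (x - y)]
    refine norm_setAverage_ball_sub_le hΛ_closed hΛ_bdd hΛ_vol
      (integrable_of_continuousOn hΛ_closed hΛ_bdd (continuousOn_translate hC_cont hx))
      Nat.one_div_pos_of_nat fun y hy hyk => ?_
    have := h (x := (x, y)) ⟨hx, hy⟩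
      (by rw [Prod.dist_eq]; exact max_lt (hsmall l hl x hxl) (hsmall k hk y hyk))
    rw [dist_eq_norm] at this
    simpa using this.le
  have hcauchy : CauchySeq X := by
    rw [Metric.cauchySeq_iff]
    intro ε hε
    obtain ⟨N, hN⟩ := key (ε ^ 2 / 8) (by positivity)
    refine ⟨N, fun k hk l hl => ?_⟩
    have h1 : ((‖X k - X l‖ : ℂ)) ^ 2 = (inner ℂ (X k) (X k) - C 0) - (inner ℂ (X k) (X l) - C 0)
        - (inner ℂ (X l) (X k) - C 0) + (inner ℂ (X l) (X l) - C 0) := by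
      have := inner_self_eq_norm_sq_to_K (𝕜 := ℂ) (X k - X l)
      rw [inner_sub_left, inner_sub_right, inner_sub_right] at this
      refine Eq.trans this.symm ?_
      ring
    have h2 : ‖X k - X l‖ ^ 2 ≤ ε ^ 2 / 8 + ε ^ 2 / 8 + ε ^ 2 / 8 + ε ^ 2 / 8 := by
      have h3 : ‖X k - X l‖ ^ 2 = ‖((‖X k - X l‖ : ℂ)) ^ 2‖ := by
        rw [norm_pow, Complex.norm_real, norm_norm]
      rw [h3, h1]
      refine (norm_add_le _ _).trans (add_le_add ?_ (hN l hl l hl))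
      refine (norm_sub_le _ _).trans (add_le_add ?_ (hN l hl k hk))
      exact (norm_sub_le _ _).trans (add_le_add (hN k hk k hk) (hN k hk l hl))
    rw [dist_eq_norm]
    nlinarith [norm_nonneg (X k - X l)]
  obtain ⟨Y, hY⟩ := cauchySeq_tendsto_of_complete hcauchy
  refine ⟨Y, hY, ?_⟩
  have h1 : Tendsto (fun k => inner ℂ (X k) (X k)) atTop (𝓝 (inner ℂ Y Y)) := hY.inner hY
  have h2 : Tendsto (fun k => inner ℂ (X k) (X k)) atTop (𝓝 (C 0)) := by
    rw [Metric.tendsto_atTop]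
    intro ε hε
    obtain ⟨N, hN⟩ := key (ε / 2) (by positivity)
    refine ⟨N, fun k hk => ?_⟩
    rw [dist_eq_norm]
    linarith [hN k hk k hk]
  rw [← tendsto_nhds_unique h1 h2, inner_self_eq_norm_sq_to_K]
  rfl

/-- The covariance of the value at `0` with the field is `x ↦ C x`. -/
theorem IsHomogeneousGaussianField.inner_limit_coefficientMap
    (hφ : IsHomogeneousGaussianField Λ C φ P) {Y : Lp ℂ 2 P}
    (hY : Tendsto (fun k => coefficientMap hφ.memLp.toLp (ballAverage hΛ_bdd k)) atTop (𝓝 Y))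
    (f : FieldSpace Λ) :
    inner ℂ Y (coefficientMap hφ.memLp.toLp f) = ∫ x in Λ, conj (f x) * C x := by
  have h1 : Tendsto (fun k => inner ℂ (coefficientMap hφ.memLp.toLp (ballAverage hΛ_bdd k))
      (coefficientMap hφ.memLp.toLp f)) atTop
      (𝓝 (inner ℂ Y (coefficientMap hφ.memLp.toLp f))) := hY.inner tendsto_const_nhds
  refine tendsto_nhds_unique h1 ?_
  simp_rw [hφ.inner_coefficientMap]
  obtain ⟨M, hM⟩ := exists_bound_covariance hΛ_closed hΛ_bdd hC_cont
  have hf := integrable_fieldSpace hΛ_bdd f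
  refine tendsto_integral_of_dominated_convergence (fun x => ‖f x‖ * M) (fun k => ?_)
    (hf.norm.mul_const M) (fun k => ?_) ?_
  · exact (Complex.continuous_conj.comp_aestronglyMeasurable hf.1).mul
      ((continuousOn_kernelOperator hΛ_closed hΛ_bdd hC_cont _).aestronglyMeasurable
        hΛ_closed.measurableSet)
  · filter_upwards [ae_restrict_mem hΛ_closed.measurableSet] with x hx
    rw [norm_mul, RCLike.norm_conj]
    refine mul_le_mul_of_nonneg_left ?_ (norm_nonneg _)
    rw [kernelOperator, integral_mul_ballAverage hΛ_bdd k fun y => C (x - y)]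
    have := norm_setAverage_ball_sub_le hΛ_closed hΛ_bdd hΛ_vol
      (integrable_of_continuousOn hΛ_closed hΛ_bdd (continuousOn_translate hC_cont hx))
      (Nat.one_div_pos_of_nat (n := k)) (z := 0) (ε := M) fun y hy _ => by
        rw [sub_zero]; exact hM x hx y hy
    rwa [sub_zero] at this
  · filter_upwards [ae_restrict_mem hΛ_closed.measurableSet] with x hx
    exact tendsto_const_nhds.mul
      (tendsto_kernelOperator_ballAverage hΛ_closed hΛ_bdd hΛ_vol hC_cont hx hΛ_zero)

end Covariance

/-! ### The value at the origin -/

section ValueAtZero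

variable {d : ℕ} {Λ : Set (EuclideanSpace ℝ (Fin d))} {C : EuclideanSpace ℝ (Fin d) → ℂ}
  {Ω : Type*} [MeasurableSpace Ω] {P : Measure Ω} {φ : Ω → FieldSpace Λ}

theorem eLpNorm_sub_sum_eq_enorm {ψ : ℕ → EuclideanSpace ℝ (Fin d) → ℂ}
    (hψ : ∀ n, MemLp (ψ n) 2 (volume.restrict Λ)) (g : FieldSpace Λ) (c : ℕ → ℂ) (N : ℕ) :
    eLpNorm (fun x => g x - ∑ n ∈ Finset.range N, c n * ψ n x) 2 (volume.restrict Λ)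
      = ‖g - ∑ n ∈ Finset.range N, c n • (hψ n).toLp‖ₑ := by
  rw [Lp.enorm_def]
  refine eLpNorm_congr_ae ?_
  have h1 : ∀ᵐ x ∂(volume.restrict Λ), ∀ n, (c n • (hψ n).toLp : FieldSpace Λ) x = c n * ψ n x := by
    rw [ae_all_iff]
    intro n
    filter_upwards [Lp.coeFn_smul (c n) (hψ n).toLp, (hψ n).coeFn_toLp] with x h1 h2
    rw [h1, Pi.smul_apply, h2, smul_eq_mul]
  filter_upwards [h1, Lp.coeFn_sub g (∑ n ∈ Finset.range N, c n • (hψ n).toLp),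
    Lp.coeFn_finsetSum (Finset.range N) fun n => c n • (hψ n).toLp] with x h1 h2 h3
  rw [h2, Pi.sub_apply, h3, Finset.sum_apply]
  simp_rw [h1]

/-- A Gaussian field with continuous covariance has an expansion with continuous profiles: the
coefficients come from the Gram-Schmidt process, and the profiles are their images under the
covariance operator. -/
theorem IsHomogeneousGaussianField.exists_isKarhunenLoeve [IsProbabilityMeasure P]
    (hΛ_closed : IsClosed Λ) (hΛ_bdd : Bornology.IsBounded Λ)
    (hC_cont : ContinuousOn
      (fun p : EuclideanSpace ℝ (Fin d) × EuclideanSpace ℝ (Fin d) => C (p.1 - p.2)) (Λ ×ˢ Λ))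
    (hφ : IsHomogeneousGaussianField Λ C φ P) : ∃ ψ ξ, IsKarhunenLoeve Λ φ P ψ ξ := by
  obtain ⟨f, horth, hnorm, hdense⟩ :=
    exists_orthonormal_or_zero_range (coefficientMap hφ.memLp.toLp)
  have hcont : ∀ n, ContinuousOn (kernelOperator Λ C (f n)) Λ := fun n =>
    continuousOn_kernelOperator hΛ_closed hΛ_bdd hC_cont (f n)
  have hψ : ∀ n, MemLp (kernelOperator Λ C (f n)) 2 (volume.restrict Λ) := fun n =>
    memLp_of_continuousOn hΛ_closed hΛ_bdd (hcont n) 2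
  refine ⟨fun n => kernelOperator Λ C (f n), fun n ω => inner ℂ (f n) (φ ω), hcont,
    fun n => hφ.gaussian (f n), ?_, ?_⟩
  · exact iIndepFun_of_orthogonal hφ.hasCircularLaw
      (fun n => Submodule.le_topologicalClosure _ ⟨f n, rfl⟩) horth
      fun n => coeFn_coefficientMap_toLp hφ.memLp (f n)
  · simp_rw [eLpNorm_sub_sum_eq_enorm hψ]
    refine tendsto_lintegral_sub_expansion hφ.memLp horth hnorm hdense fun n g => ?_
    rw [hφ.inner_coefficientMap, inner_toLp]

/-- The series of any expansion, evaluated at `0`, converges almost surely to the mean square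
limit of the local averages: the latter has Fourier coefficients `ψₙ(0)` along the orthogonal
family `ξₙ`. -/
theorem IsHomogeneousGaussianField.ae_tendsto_series [IsProbabilityMeasure P]
    (hΛ_closed : IsClosed Λ) (hΛ_bdd : Bornology.IsBounded Λ) (hΛ_zero : 0 ∈ Λ)
    (hΛ_vol : ∀ r > 0, 0 < volume (Λ ∩ Metric.ball 0 r))
    (hφ : IsHomogeneousGaussianField Λ C φ P) {Y : Lp ℂ 2 P}
    (hY : Tendsto (fun k => coefficientMap hφ.memLp.toLp (ballAverage hΛ_bdd k)) atTop (𝓝 Y))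
    {ψ : ℕ → EuclideanSpace ℝ (Fin d) → ℂ} {ξ : ℕ → Ω → ℂ} (hKL : IsKarhunenLoeve Λ φ P ψ ξ) :
    ∀ᵐ ω ∂P, Tendsto (fun N : ℕ => ∑ n ∈ Finset.range N, ξ n ω * ψ n 0) atTop (𝓝 (Y ω)) := by
  set T := coefficientMap hφ.memLp.toLp with hT
  have hψ : ∀ n, MemLp (ψ n) 2 (volume.restrict Λ) := fun n =>
    memLp_of_continuousOn hΛ_closed hΛ_bdd (hKL.continuousOn n) 2
  set Ψ : ℕ → FieldSpace Λ := fun n => (hψ n).toLp with hΨ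
  have hξ2 : ∀ n, MemLp (ξ n) 2 P := fun n => (hKL.gaussian n).hasGaussianLaw.memLp_two
  set X : ℕ → Lp ℂ 2 P := fun n => (hξ2 n).toLp with hX
  have hXξ : ∀ n, X n =ᵐ[P] ξ n := fun n => (hξ2 n).coeFn_toLp
  have horth : Pairwise fun i j => inner ℂ (X i) (X j) = 0 := by
    intro i j hij
    have hind : IndepFun (fun ω => conj (ξ i ω)) (ξ j) P :=
      (hKL.indep.indepFun hij).comp (φ := conj) (ψ := id)
        Complex.continuous_conj.measurable measurable_id
    have h1 := hind.integral_fun_mul_eq_mul_integral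
      (Complex.continuous_conj.comp_aestronglyMeasurable (hξ2 i).1) (hξ2 j).1
    rw [(hKL.gaussian j).mean_zero, mul_zero] at h1
    rw [L2.inner_def, ← h1]
    refine integral_congr_ae ?_
    filter_upwards [hXξ i, hXξ j] with ω h1 h2
    rw [h1, h2, RCLike.inner_apply, mul_comm]
  have hexp := hKL.expansion
  simp_rw [eLpNorm_sub_sum_eq_enorm hψ] at hexp
  have hTlim : ∀ f, Tendsto (fun N => ∑ n ∈ Finset.range N, inner ℂ f (Ψ n) • X n) atTop
      (𝓝 (T f)) := by
    intro f
    rw [tendsto_iff_edist_tendsto_0]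
    have hle : ∀ N, edist (∑ n ∈ Finset.range N, inner ℂ f (Ψ n) • X n) (T f) ^ 2
        ≤ ‖f‖ₑ ^ 2 * ∫⁻ ω, ‖φ ω - ∑ n ∈ Finset.range N, ξ n ω • Ψ n‖ₑ ^ 2 ∂P := by
      intro N
      rw [edist_comm, edist_eq_enorm_sub, enorm_sq_eq_lintegral_of_ae
        (coeFn_coefficientMap_sub_sum hφ.memLp Ψ hXξ f N),
        ← lintegral_const_mul' _ _ (ENNReal.pow_ne_top enorm_ne_top)]
      refine lintegral_mono fun ω => ?_
      rw [← mul_pow]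
      refine pow_le_pow_left' ?_ 2
      rw [← ofReal_norm, ← ofReal_norm, ← ofReal_norm, ← ENNReal.ofReal_mul (norm_nonneg _)]
      exact ENNReal.ofReal_le_ofReal (norm_inner_le_norm _ _)
    have h1 : Tendsto (fun N => edist (∑ n ∈ Finset.range N, inner ℂ f (Ψ n) • X n) (T f) ^ 2)
        atTop (𝓝 0) := by
      have h2 := ENNReal.Tendsto.const_mul (a := ‖f‖ₑ ^ 2) hexp
        (Or.inr (ENNReal.pow_ne_top enorm_ne_top))
      rw [mul_zero] at h2
      exact tendsto_of_tendsto_of_tendsto_of_le_of_le tendsto_const_nhds h2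
        (fun _ => bot_le) hle
    have h3 := (ENNReal.continuous_rpow_const (y := 1 / 2)).tendsto 0 |>.comp h1
    rw [ENNReal.zero_rpow_of_pos (by norm_num)] at h3
    refine h3.congr fun N => ?_
    rw [Function.comp_apply, ← ENNReal.rpow_natCast, ← ENNReal.rpow_mul]
    norm_num
  have hcoef : ∀ f n, inner ℂ (X n) (T f) = inner ℂ f (Ψ n) * (‖X n‖ : ℂ) ^ 2 := by
    intro f n
    have h1 := (tendsto_const_nhds (x := X n)).inner (𝕜 := ℂ) (hTlim f)
    refine tendsto_nhds_unique h1 (tendsto_const_nhds.congr' ?_)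
    filter_upwards [eventually_gt_atTop n] with N hN
    rw [inner_sum, Finset.sum_eq_single n]
    · rw [inner_smul_right, inner_self_eq_norm_sq_to_K]; rfl
    · intro m _ hm
      rw [inner_smul_right, horth hm.symm, mul_zero]
    · intro h; simp at h; omega
  have hcoefY : ∀ n, inner ℂ (X n) Y = ψ n 0 * (‖X n‖ : ℂ) ^ 2 := by
    intro n
    have h1 := (tendsto_const_nhds (x := X n)).inner (𝕜 := ℂ) hY
    refine tendsto_nhds_unique h1 ?_
    simp_rw [hcoef, inner_ballAverage]
    refine Tendsto.mul_const _ ?_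
    refine (tendsto_setAverage_ball hΛ_closed hΛ_bdd hΛ_vol
      (integrable_of_continuousOn hΛ_closed hΛ_bdd (hKL.continuousOn n))
      (hKL.continuousOn n 0 hΛ_zero)).congr fun k => ?_
    refine setAverage_congr_fun measurableSet_ball ?_
    filter_upwards [(hψ n).coeFn_toLp] with x hx _ using hx.symm
  have hmem : Y ∈ closure (Submodule.span ℂ (Set.range X) : Set (Lp ℂ 2 P)) := by
    refine isClosed_closure.mem_of_tendsto hY (Eventually.of_forall fun k => ?_)
    refine mem_closure_of_tendsto (hTlim _) (Eventually.of_forall fun N => ?_)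
    exact Submodule.sum_mem _ fun n _ => Submodule.smul_mem _ _ (Submodule.subset_span ⟨n, rfl⟩)
  refine ae_tendsto_sum_of_tendsto_Lp (X := fun n => ψ n 0 • X n) (fun n => ?_) ?_ (fun n => ?_)
    (tendsto_orthogonal_expansion horth hmem hcoefY)
  · filter_upwards [Lp.coeFn_smul (ψ n 0) (X n), hXξ n] with ω h1 h2
    rw [h1, Pi.smul_apply, h2, smul_eq_mul, mul_comm]
  · exact hKL.indep.comp (fun n z => z * ψ n 0) fun n => measurable_id.mul_const _
  · rw [integral_mul_const, (hKL.gaussian n).mean_zero, zero_mul]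

/-- The mean square limit of the local averages is the value at `0` of the field. -/
theorem IsHomogeneousGaussianField.isValueAtZero [IsProbabilityMeasure P]
    (hΛ_closed : IsClosed Λ) (hΛ_bdd : Bornology.IsBounded Λ) (hΛ_zero : 0 ∈ Λ)
    (hΛ_vol : ∀ r > 0, 0 < volume (Λ ∩ Metric.ball 0 r))
    (hC_cont : ContinuousOn
      (fun p : EuclideanSpace ℝ (Fin d) × EuclideanSpace ℝ (Fin d) => C (p.1 - p.2)) (Λ ×ˢ Λ))
    (hφ : IsHomogeneousGaussianField Λ C φ P) {Y : Lp ℂ 2 P}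
    (hY : Tendsto (fun k => coefficientMap hφ.memLp.toLp (ballAverage hΛ_bdd k)) atTop (𝓝 Y)) :
    IsValueAtZero Λ φ P Y where
  measurable := (Lp.stronglyMeasurable Y).measurable
  exists_expansion := hφ.exists_isKarhunenLoeve hΛ_closed hΛ_bdd hC_cont
  series_tendsto _ _ hKL := hφ.ae_tendsto_series hΛ_closed hΛ_bdd hΛ_zero hΛ_vol hY hKL
  eq_of_continuous := by
    obtain ⟨ns, hns, hsub⟩ := (tendstoInMeasure_of_tendsto_Lp hY).exists_seq_tendsto_ae
    filter_upwards [hsub, ae_all_iff.2 fun k =>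
      coeFn_coefficientMap_toLp hφ.memLp (ballAverage hΛ_bdd k)] with ω h1 h2 f hf hfc
    have hfi : Integrable f (volume.restrict Λ) :=
      (integrable_fieldSpace hΛ_bdd (φ ω)).congr hf.symm
    have h3 := (tendsto_setAverage_ball hΛ_closed hΛ_bdd hΛ_vol hfi hfc).comp hns.tendsto_atTop
    refine tendsto_nhds_unique h1 (h3.congr fun i => ?_)
    rw [h2, inner_ballAverage, Function.comp_apply]
    refine setAverage_congr_fun measurableSet_ball ?_
    filter_upwards [hf] with x hx _ using hx

end ValueAtZero

/-! ### Convergence of the normalised profile -/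

section Profile

variable {d : ℕ} {Λ : Set (EuclideanSpace ℝ (Fin d))} {C : EuclideanSpace ℝ (Fin d) → ℂ}
  {Ω : Type*} [MeasurableSpace Ω] {P : Measure Ω} {φ : Ω → FieldSpace Λ}

theorem profileDist_eq_enorm (g : FieldSpace Λ) (hC : MemLp C 2 (volume.restrict Λ)) (θ : ℝ) :
    profileDist Λ g C θ = ‖((‖g‖ : ℂ)⁻¹) • g
      - (Complex.exp (θ * Complex.I) * (‖hC.toLp‖ : ℂ)⁻¹) • hC.toLp‖ₑ := by
  rw [Lp.enorm_def, profileDist]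
  refine eLpNorm_congr_ae ?_
  have hCn : eLpNorm C 2 (volume.restrict Λ) = eLpNorm hC.toLp 2 (volume.restrict Λ) :=
    eLpNorm_congr_ae hC.coeFn_toLp.symm
  filter_upwards [hC.coeFn_toLp, Lp.coeFn_smul ((‖g‖ : ℂ)⁻¹) g,
    Lp.coeFn_smul (Complex.exp (θ * Complex.I) * (‖hC.toLp‖ : ℂ)⁻¹) hC.toLp,
    Lp.coeFn_sub (((‖g‖ : ℂ)⁻¹) • g)
      ((Complex.exp (θ * Complex.I) * (‖hC.toLp‖ : ℂ)⁻¹) • hC.toLp)] with x h1 h2 h3 h4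
  rw [h4, Pi.sub_apply, h2, h3, Pi.smul_apply, Pi.smul_apply, h1, l2Normalize, l2Normalize, hCn,
    ← Lp.norm_def, ← Lp.norm_def, smul_eq_mul, smul_eq_mul]
  ring

/-- The distance between the normalised profiles, in terms of the remainder of the field after
its regression on the value `z` at `0`. -/
theorem profileDist_le (g : FieldSpace Λ) (hC : MemLp C 2 (volume.restrict Λ))
    (hC0 : hC.toLp ≠ 0) {z : ℂ} (hz : z ≠ 0) {c : ℝ} (hc : 0 < c) :
    profileDist Λ g C (phase z)
      ≤ ENNReal.ofReal (2 * c / (‖hC.toLp‖ * ‖z‖)) * ‖g - (z / c) • hC.toLp‖ₑ := by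
  have hz' : 0 < ‖z‖ := norm_pos_iff.2 hz
  have hC' : 0 < ‖hC.toLp‖ := norm_pos_iff.2 hC0
  have hzc : z / c ≠ 0 := div_ne_zero hz (by exact_mod_cast hc.ne')
  have hb : (z / c) • hC.toLp ≠ 0 := smul_ne_zero hzc hC0
  have hbn : ‖(z / c) • hC.toLp‖ = ‖z‖ / c * ‖hC.toLp‖ := by
    rw [norm_smul, norm_div, Complex.norm_real, Real.norm_of_nonneg hc.le]
  have h1 : ((‖(z / c) • hC.toLp‖ : ℂ)⁻¹) • ((z / c) • hC.toLp)
      = (Complex.exp (phase z * Complex.I) * (‖hC.toLp‖ : ℂ)⁻¹) • hC.toLp := by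
    rw [hbn, smul_smul]
    congr 1
    have e1 : (‖z‖ : ℂ) ≠ 0 := by exact_mod_cast hz'.ne'
    have e2 : (c : ℂ) ≠ 0 := by exact_mod_cast hc.ne'
    have e3 : (‖hC.toLp‖ : ℂ) ≠ 0 := by exact_mod_cast hC'.ne'
    have e4 := norm_mul_exp_phase_mul_I z
    push_cast
    generalize Complex.exp (phase z * Complex.I) = w at e4 ⊢
    field_simp
    exact e4.symm
  have h2 := norm_normalize_sub_le g hb
  rw [h1] at h2
  rw [profileDist_eq_enorm g hC, ← ofReal_norm, ← ofReal_norm,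
    ← ENNReal.ofReal_mul (by positivity)]
  refine ENNReal.ofReal_le_ofReal (h2.trans_eq ?_)
  rw [hbn]
  field_simp

/-- Conditioning on an independent variable does not change expectations. -/
theorem lintegral_cond_of_indepFun [IsProbabilityMeasure P] {H : Type*} [MeasurableSpace H]
    {χ : Ω → H} {y : Ω → ℂ} (hχ : AEMeasurable χ P) (hy : Measurable y) (h : IndepFun χ y P)
    {F : H → ℝ≥0∞} (hF : Measurable F) {s : Set ℂ} (hs : MeasurableSet s)
    (hP : P {ω | y ω ∈ s} ≠ 0) :
    ∫⁻ ω, F (χ ω) ∂P[|{ω | y ω ∈ s}] = ∫⁻ ω, F (χ ω) ∂P := by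
  set A : Set Ω := {ω | y ω ∈ s}
  have hA : MeasurableSet A := hy hs
  have h1 : IndepFun (fun ω => F (χ ω)) (fun ω => s.indicator (fun _ => (1 : ℝ≥0∞)) (y ω)) P :=
    h.comp hF (measurable_const.indicator hs)
  have h2 := lintegral_mul_eq_lintegral_mul_lintegral_of_indepFun'' (hF.comp_aemeasurable hχ)
    ((measurable_const.indicator hs).comp hy).aemeasurable h1
  have h3 : ∫⁻ ω, s.indicator (fun _ => (1 : ℝ≥0∞)) (y ω) ∂P = P A := by
    rw [← lintegral_indicator_one hA]
    rfl
  have h4 : ∫⁻ ω, F (χ ω) * s.indicator (fun _ => (1 : ℝ≥0∞)) (y ω) ∂P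
      = ∫⁻ ω in A, F (χ ω) ∂P := by
    rw [← lintegral_indicator hA]
    refine lintegral_congr fun ω => ?_
    by_cases hω : y ω ∈ s
    · rw [Set.indicator_of_mem hω, Set.indicator_of_mem (show ω ∈ A from hω), mul_one]
    · rw [Set.indicator_of_notMem hω, Set.indicator_of_notMem (show ω ∉ A from hω), mul_zero]
  simp only [Function.comp_apply] at h2
  rw [ProbabilityTheory.cond, lintegral_smul_measure, ← h4, h2, h3, smul_eq_mul, mul_comm,
    mul_assoc, ENNReal.mul_inv_cancel hP (measure_ne_top _ _), mul_one]

/-- The remainder of the field after its regression on the value at `0` is independent of that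
value. -/
theorem IsHomogeneousGaussianField.indepFun_remainder [IsProbabilityMeasure P]
    [MeasurableSpace (FieldSpace Λ)] [BorelSpace (FieldSpace Λ)]
    (hφ : IsHomogeneousGaussianField Λ C φ P) (hC : MemLp C 2 (volume.restrict Λ)) {Y : Lp ℂ 2 P}
    (hYG : Y ∈ (LinearMap.range (coefficientMap hφ.memLp.toLp).toLinearMap).topologicalClosure)
    (hY0 : Y ≠ 0)
    (hYC : ∀ f, inner ℂ Y (coefficientMap hφ.memLp.toLp f) = inner ℂ f hC.toLp) :
    IndepFun (fun ω => φ ω - (Y ω / (‖Y‖ ^ 2 : ℝ)) • hC.toLp) Y P := by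
  set T := coefficientMap hφ.memLp.toLp with hT
  set c : ℝ := ‖Y‖ ^ 2 with hc
  have hc0 : (c : ℂ) ≠ 0 := by
    have := norm_pos_iff.2 hY0
    exact_mod_cast (by positivity : c ≠ 0)
  refine indepFun_of_orthogonal hφ.hasCircularLaw ?_ hYG (Y := Y) EventuallyEq.rfl
    (Z := fun f => T f - (inner ℂ f hC.toLp / c) • Y) (fun f => ?_) (fun f => ?_) (fun f => ?_)
  · have hY : AEStronglyMeasurable (fun ω => Y ω / (c : ℂ)) P := by
      simpa only [div_eq_mul_inv] using (Lp.aestronglyMeasurable Y).mul_const ((c : ℂ)⁻¹)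
    exact (hφ.memLp.1.sub (hY.smul_const _)).aemeasurable
  · exact Submodule.sub_mem _ (Submodule.le_topologicalClosure _ ⟨f, rfl⟩)
      (Submodule.smul_mem _ _ hYG)
  · filter_upwards [coeFn_coefficientMap_toLp hφ.memLp f,
      Lp.coeFn_smul (inner ℂ f hC.toLp / (c : ℂ)) Y,
      Lp.coeFn_sub (T f) ((inner ℂ f hC.toLp / (c : ℂ)) • Y)] with ω h1 h2 h3
    rw [h3, Pi.sub_apply, h2, Pi.smul_apply, h1, inner_sub_right, inner_smul_right, smul_eq_mul]
    ring
  · rw [inner_sub_right, inner_smul_right, hYC, inner_self_eq_norm_sq_to_K]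
    have : ((‖Y‖ : ℂ)) ^ 2 = c := by rw [hc]; push_cast; rfl
    change _ - _ * ((‖Y‖ : ℂ)) ^ 2 = 0
    rw [this, div_mul_cancel₀ _ hc0, sub_self]

end Profile

theorem proposition3 {d : ℕ} (Λ : Set (EuclideanSpace ℝ (Fin d)))
    (hΛ_closed : IsClosed Λ) (hΛ_bdd : Bornology.IsBounded Λ) (hΛ_zero : 0 ∈ Λ)
    (hΛ_vol : ∀ r > 0, 0 < volume (Λ ∩ Metric.ball 0 r))
    (C : EuclideanSpace ℝ (Fin d) → ℂ)
    (hC_cont : ContinuousOn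
      (fun p : EuclideanSpace ℝ (Fin d) × EuclideanSpace ℝ (Fin d) => C (p.1 - p.2)) (Λ ×ˢ Λ))
    (hC_zero : C 0 ≠ 0)
    {Ω : Type*} [MeasurableSpace Ω] (P : Measure Ω) [IsProbabilityMeasure P]
    (φ : Ω → FieldSpace Λ) (hφ : IsHomogeneousGaussianField Λ C φ P) :
    ∃ φ₀ : Ω → ℂ, IsValueAtZero Λ φ P φ₀ ∧
      ∃ θ : Ω → ℝ, Measurable θ ∧
        (∀ ω, θ ω ∈ Set.Ico 0 (2 * Real.pi)) ∧
        (∀ ω, φ₀ ω = (‖φ₀ ω‖ : ℂ) * Complex.exp (θ ω * Complex.I)) ∧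
        pdf.IsUniform θ (Set.Ico 0 (2 * Real.pi)) P ∧
        (∀ u : ℝ, 0 < u → pdf.IsUniform θ (Set.Ico 0 (2 * Real.pi)) P[|{ω | u < ‖φ₀ ω‖ ^ 2}]) ∧
        (∀ ε : ℝ, 0 < ε → Tendsto
          (fun u : ℝ => P[|{ω | u < ‖φ₀ ω‖ ^ 2}]
            {ω | ENNReal.ofReal ε < profileDist Λ (φ ω) C (θ ω)}) atTop (𝓝 0)) ∧
        Tendsto
          (fun u : ℝ => ∫⁻ ω, profileDist Λ (φ ω) C (θ ω) ^ 2 ∂P[|{ω | u < ‖φ₀ ω‖ ^ 2}])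
          atTop (𝓝 0) := by
  obtain ⟨Y, hY, hYC0⟩ := hφ.exists_tendsto_ballAverage hΛ_closed hΛ_bdd hΛ_zero hΛ_vol hC_cont
  have hY0 : Y ≠ 0 := by
    rintro rfl
    exact hC_zero (by rw [← hYC0]; simp)
  have hcontC := continuousOn_of_zero_mem hΛ_zero hC_cont
  have hC := memLp_of_continuousOn hΛ_closed hΛ_bdd hcontC 2
  -- `C` does not vanish in `L²`, as its averages over small balls tend to `C 0`.
  have hC0 : hC.toLp ≠ 0 := by
    intro h0
    have h1 := tendsto_setAverage_ball hΛ_closed hΛ_bdd hΛ_vol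
      (integrable_of_continuousOn hΛ_closed hΛ_bdd hcontC) (hcontC 0 hΛ_zero)
    refine hC_zero (tendsto_nhds_unique h1 (tendsto_const_nhds.congr fun k => ?_))
    have h2 := hC.coeFn_toLp
    rw [h0] at h2
    rw [setAverage_eq, integral_eq_zero_of_ae, smul_zero]
    filter_upwards [ae_restrict_of_ae h2,
      ae_restrict_of_ae (Lp.coeFn_zero ℂ 2 (volume.restrict Λ))] with x h3 h4
    rw [← h3, h4]
  have hYG : Y ∈ (LinearMap.range (coefficientMap hφ.memLp.toLp).toLinearMap).topologicalClosure :=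
    mem_closure_of_tendsto hY (Eventually.of_forall fun k => ⟨_, rfl⟩)
  have hcirc : ∀ a : ℂ, HasCircularLaw (a • Y) := fun a =>
    hφ.hasCircularLaw _ (Submodule.smul_mem _ a hYG)
  have hYm : Measurable Y := (Lp.stronglyMeasurable Y).measurable
  have hYY : Y =ᵐ[P] (Y : Ω → ℂ) := EventuallyEq.rfl
  have hpos : ∀ u : ℝ, P {ω | u < ‖Y ω‖ ^ 2} ≠ 0 := measure_lt_norm_sq_ne_zero hcirc hYY hY0
  have hAm : ∀ u : ℝ, MeasurableSet {ω | u < ‖Y ω‖ ^ 2} := fun u =>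
    measurableSet_lt measurable_const (hYm.norm.pow_const 2)
  borelize (FieldSpace Λ)
  set χ : Ω → FieldSpace Λ := fun ω => φ ω - (Y ω / (‖Y‖ ^ 2 : ℝ)) • hC.toLp with hχ
  have hind : IndepFun χ Y P := hφ.indepFun_remainder hC hYG hY0 fun f => by
    rw [hφ.inner_limit_coefficientMap hΛ_closed hΛ_bdd hΛ_zero hΛ_vol hC_cont hY, inner_toLp]
  have hYdiv : MemLp (fun ω => Y ω / (‖Y‖ ^ 2 : ℝ)) 2 P := by
    simpa only [div_eq_mul_inv] using (Lp.memLp Y).mul_const (((‖Y‖ ^ 2 : ℝ) : ℂ)⁻¹)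
  have hχ2 : MemLp χ 2 P := by
    refine hφ.memLp.sub ?_
    exact (ContinuousLinearMap.toSpanSingleton ℂ hC.toLp).comp_memLp' hYdiv
  have hχfin : ∫⁻ ω, ‖χ ω‖ₑ ^ 2 ∂P ≠ ∞ := by
    rw [← eLpNorm_two_sq]
    exact ENNReal.pow_ne_top hχ2.2.ne
  set K : ℝ := (2 * ‖Y‖ ^ 2 / ‖hC.toLp‖) ^ 2 with hK
  have hbound : ∀ u : ℝ, 0 < u → ∀ᵐ ω ∂P[|{ω | u < ‖Y ω‖ ^ 2}],
      profileDist Λ (φ ω) C (phase (Y ω)) ^ 2 ≤ ENNReal.ofReal (K / u) * ‖χ ω‖ₑ ^ 2 := by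
    intro u hu
    filter_upwards [ae_cond_mem (hAm u)] with ω hω
    have hω' : u < ‖Y ω‖ ^ 2 := hω
    have hz : Y ω ≠ 0 := by
      intro h0
      rw [h0, norm_zero] at hω'
      norm_num at hω'
      linarith
    have hYpos := norm_pos_iff.2 hY0
    have hCpos := norm_pos_iff.2 hC0
    have hzpos := norm_pos_iff.2 hz
    have h1 := profileDist_le (φ ω) hC hC0 hz (c := ‖Y‖ ^ 2) (by positivity)
    refine (pow_le_pow_left' h1 2).trans ?_
    rw [mul_pow, ← ENNReal.ofReal_pow (by positivity)]
    refine mul_le_mul_left (ENNReal.ofReal_le_ofReal ?_) _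
    rw [hK, div_pow, div_pow, div_div, mul_pow (‖hC.toLp‖)]
    gcongr
  have hcondχ : ∀ u : ℝ, ∫⁻ ω, ‖χ ω‖ₑ ^ 2 ∂P[|{ω | u < ‖Y ω‖ ^ 2}] = ∫⁻ ω, ‖χ ω‖ₑ ^ 2 ∂P :=
    fun u => lintegral_cond_of_indepFun (s := {z : ℂ | u < ‖z‖ ^ 2}) hχ2.1.aemeasurable hYm hind
      (measurable_enorm.pow_const 2) (measurableSet_lt measurable_const (by fun_prop)) (hpos u)
  have hlim : Tendsto (fun u : ℝ => ENNReal.ofReal (K / u) * ∫⁻ ω, ‖χ ω‖ₑ ^ 2 ∂P) atTop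
      (𝓝 0) := by
    have h1 : Tendsto (fun u : ℝ => ENNReal.ofReal (K / u)) atTop (𝓝 0) := by
      have := (ENNReal.continuous_ofReal.tendsto 0).comp
        (tendsto_const_nhds (x := K) |>.div_atTop tendsto_id)
      rwa [ENNReal.ofReal_zero] at this
    have h2 := ENNReal.Tendsto.mul_const (b := ∫⁻ ω, ‖χ ω‖ₑ ^ 2 ∂P) h1 (Or.inr hχfin)
    rwa [zero_mul] at h2
  have huniform : ∀ u : ℝ, pdf.IsUniform (fun ω => phase (Y ω)) (Set.Ico 0 (2 * Real.pi))
      P[|{ω | u < ‖Y ω‖ ^ 2}] := fun u =>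
    isUniform_phase_cond hcirc hYY hY0 hYm (s := {r : ℝ | u < r ^ 2})
      (measurableSet_lt measurable_const (by fun_prop)) (hpos u)
  refine ⟨Y, hφ.isValueAtZero hΛ_closed hΛ_bdd hΛ_zero hΛ_vol hC_cont hY, fun ω => phase (Y ω),
    measurable_phase.comp hYm, fun ω => phase_mem_Ico _,
    fun ω => (norm_mul_exp_phase_mul_I _).symm, ?_, fun u _ => huniform u, fun ε hε => ?_, ?_⟩
  -- Conditioning on a sure event leaves `P` unchanged.
  · have h1 : {ω | (-1 : ℝ) < ‖Y ω‖ ^ 2} = Set.univ :=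
      Set.eq_univ_of_forall fun ω => (by norm_num : (-1 : ℝ) < 0).trans_le (sq_nonneg ‖Y ω‖)
    have h2 := huniform (-1)
    rwa [h1, cond_univ] at h2
  · have hε2 : ENNReal.ofReal ε ^ 2 ≠ 0 := by
      simpa using hε
    have h1 := ENNReal.Tendsto.div_const hlim (b := ENNReal.ofReal ε ^ 2) (Or.inr hε2)
    rw [ENNReal.zero_div] at h1
    refine tendsto_of_tendsto_of_tendsto_of_le_of_le' tendsto_const_nhds h1
      (Eventually.of_forall fun _ => bot_le) ?_
    filter_upwards [eventually_gt_atTop 0] with u hu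
    have hae : AEMeasurable (fun ω => ENNReal.ofReal (K / u) * ‖χ ω‖ₑ ^ 2)
        P[|{ω | u < ‖Y ω‖ ^ 2}] :=
      ((hχ2.1.enorm.pow_const 2).const_mul _).mono_ac cond_absolutelyContinuous
    calc _ ≤ P[|{ω | u < ‖Y ω‖ ^ 2}]
          {ω | ENNReal.ofReal ε ^ 2 ≤ ENNReal.ofReal (K / u) * ‖χ ω‖ₑ ^ 2} := by
          refine measure_mono_ae ?_
          filter_upwards [hbound u hu] with ω h1 h2
          exact (pow_le_pow_left' (le_of_lt h2) 2).trans h1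
      _ ≤ (∫⁻ ω, ENNReal.ofReal (K / u) * ‖χ ω‖ₑ ^ 2 ∂P[|{ω | u < ‖Y ω‖ ^ 2}])
          / ENNReal.ofReal ε ^ 2 :=
          meas_ge_le_lintegral_div hae hε2 (ENNReal.pow_ne_top ENNReal.ofReal_ne_top)
      _ = _ := by rw [lintegral_const_mul' _ _ ENNReal.ofReal_ne_top, hcondχ]
  · refine tendsto_of_tendsto_of_tendsto_of_le_of_le' tendsto_const_nhds hlim
      (Eventually.of_forall fun _ => bot_le) ?_
    filter_upwards [eventually_gt_atTop 0] with u hu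
    refine (lintegral_mono_ae (hbound u hu)).trans_eq ?_
    rw [lintegral_const_mul' _ _ ENNReal.ofReal_ne_top, hcondχ]
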